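/- Let $d\ge 3$, let $e_1,\dots,e_d$ be the standard basis of $\mathbb Z^d$ and $e_1^\vee,\dots,e_d^\vee$ the dual basis of $(\mathbb Z^d)^\vee$. Let $\mathbf m=(m_1,\dots,m_{d-1})$ be an admissible sequence of free parameters: each $m_i=(m_{i,1},\dots,m_{i,d})\in(\mathbb Z^d)^\vee$ is non-zero, $m_{i,j}=0$ for $i<j$, and, for the polytopes $P^{(1)}_{\mathbf m}=\{e_1\}$ and $$P^{(i)}_{\mathbf m}=\operatorname{conv}\bigl(P^{(i-1)}_{\mathbf m}\cup\{x+\langle m_{i-1},x\rangle e_i : x\in P^{(i-1)}_{\mathbf m}\}\bigr)\quad(2\le i\le d),$$ one has $\langle m_{i-1},x\rangle\ge 0$ for all $x\in P^{(i-1)}_{\mathbf m}$. Let $P\subset\{x\in\mathbb R^d: x_1=1\}$ be a lattice polytope that is lattice equivalent to $P^{(d)}_{\mathbf m}$, i.e. there is an affine map of $\mathbb R^d$ that restricts to a bijection $\operatorname{aff}(P)\to\operatorname{aff}(P^{(d)}_{\mathbf m})$ and maps $P$ onto $P^{(d)}_{\mathbf m}$ and the subgroup generated by $\operatorname{aff}(P)\cap\mathbb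 Z^d$ onto the one generated by $\operatorname{aff}(P^{(d)}_{\mathbf m})\cap\mathbb Z^d$. For a polytope $Q$ let $\tau_Q=\{\kappa x:\kappa\ge0,\ x\in Q\}$ and $U_{\tau_Q}=\operatorname{Spec}\mathbb C[(\mathbb Z^d)^\vee\cap\tau_Q^\vee]$; let $\mathbf e(a)$ denote the character of $a\in(\mathbb Z^d)^\vee\cap\tau_Q^\vee$. Write $\tau=\tau_{P^{(d)}_{\mathbf m}}$, and let $\mathbf{Hilb}$ be the set of non-zero elements of $(\mathbb Z^d)^\vee\cap\tau^\vee$ that are not a sum of two non-zero elements of $(\mathbb Z^d)^\vee\cap\tau^\vee$. For $1\le j\le d-1$ define $\lambda_{0,j}=0$ and, for $i=j-1,\dots,1$ successively, $$\lambda_{i,j}=\min\Bigl\{0,\ m_{j,i+1}+\sum_{k=i+1}^{j-1}m_{k,i+1}\lambda_{k,j}\Bigr\},\qquad \mu_{i,j}=\max\Bigl\{0,\ m_{j,i+1}+\sum_{k=i+1}^{j-1}m_{k,i+1}\lambda_{k,j}\Bigr\},$$ and $\mu_{0,j}=m_{j,1}+\sum_{k=1}^{j-1}m_{k,1}\lambda_{k,j}$.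 Consider in $\mathbb C[z_1,\dots,z_{2d-1}]$ the polynomials $$f_j=\prod_{i=1}^{j}z_i^{\mu_{i-1,j}}z_{d+i-1}^{-\lambda_{i-1,j}}-z_{j+1}z_{d+j},\qquad 1\le j\le d-1 .$$ Let $$\mathfrak Q=\{k\in\{1,\dots,d-1\}: e_k^\vee=m_{\gamma}\text{ for some }\gamma\in\{k,\dots,d-1\}\},$$ $$\mathfrak R=\{l\in\{1,\dots,d-2\}: m_l-e_{l+1}^\vee=m_{\delta}\text{ for some }\delta\in\{l+1,\dots,d-1\}\},$$ and choose for each $k\in\mathfrak Q$ such an index $\gamma_k$ and for each $l\in\mathfrak R$ such an index $\delta_l$ (arbitrarily, if there are several). Then all $\mu_{i,j}\ge 0$ and $\lambda_{i,j}\le 0$, $\mathbf{Hilb}$ is finite, $U_{\tau_P}\cong U_{\tau}$ over $\mathbb C$, and the following hold. 1. (Minimal embedding.) $U_\tau$ is isomorphic over $\mathbb C$ to a closed subscheme of $\mathbb C^{\#\mathbf{Hilb}}$, and $\#\mathbf{Hilb}$ is the least number with this property. The ideal generated by the $\mathbf e(a)$, $a\ne0$, is a maximal ideal of the coordinate ring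 of $U_\tau$, and $\#\mathbf{Hilb}$ is the minimal number of generators of the maximal ideal of the local ring of $U_\tau$ at the corresponding point. 2. (Elimination.) Assign $e_k^\vee$ to $z_k$ for $1\le k\le d$ and $m_l-e_{l+1}^\vee$ to $z_{d+l}$ for $1\le l\le d-1$. This restricts to a bijection from the set of the variables $z_k$, $k\in\{1,\dots,d\}\smallsetminus\mathfrak Q$, and $z_{d+l}$, $l\in\{1,\dots,d-1\}\smallsetminus\mathfrak R$, onto $\mathbf{Hilb}$. Let $\mathcal I$ be the ideal of the polynomial ring over $\mathbb C$ in these remaining variables that is generated by the polynomials obtained from the $f_j$, $j\notin\{\gamma_k: k\in\mathfrak Q\}\cup\{\delta_l: l\in\mathfrak R\}$, by carrying out the substitutions $z_k=z_{\gamma_k+1}z_{d+\gamma_k}$ $(k\in\mathfrak Q)$ and $z_{d+l}=z_{\delta_l+1}z_{d+\delta_l}$ $(l\in\mathfrak R)$ until no variable $z_k$ with $k\in\mathfrak Q$ or $z_{d+l}$ with $l\in\mathfrak R$ is left. These generators are pairwise distinct binomials (differences of two different monomials), and there are exactly $\#\mathbf{Hilb}-d$ of them. Moreover $$U_{\tau_P}\cong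 U_{\tau}\cong\operatorname{Spec}\bigl(\mathbb C[\{z_k: k\in\{1,\dots,d\}\smallsetminus\mathfrak Q\}\cup\{z_{d+l}: l\in\{1,\dots,d-1\}\smallsetminus\mathfrak R\}]/\mathcal I\bigr),$$ where an isomorphism from the quotient ring to the coordinate ring of $U_\tau$ is given by $z_k\mapsto\mathbf e(e_k^\vee)$ and $z_{d+l}\mapsto\mathbf e(m_l-e_{l+1}^\vee)$. -/

import Mathlib

open CategoryTheory AlgebraicGeometry

noncomputable section

namespace ToricLCI

/-! ## Cones, dual monoids, Hilbert bases, affine toric varieties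

The lattice is `ℤ^d ⊂ ℝ^d`; elements of the dual lattice `(ℤ^d)^∨` are written as integral row
vectors `Fin d → ℤ`. -/

/-- The pairing `⟨a, x⟩` of a dual lattice vector `a` with a point `x` of `ℝ^d`. -/
def pair {d : ℕ} (a : Fin d → ℤ) (x : Fin d → ℝ) : ℝ := ∑ i, (a i : ℝ) * x i

/-- The cone `τ_P = pos(P) = {κ x | κ ≥ 0, x ∈ P}` supporting a polytope `P`. -/
def coneOver {d : ℕ} (P : Set (Fin d → ℝ)) : Set (Fin d → ℝ) :=
  {y | ∃ κ : ℝ, 0 ≤ κ ∧ ∃ x ∈ P, y = κ • x}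

/-- The monoid `(ℤ^d)^∨ ∩ σ^∨` of the lattice points of the dual cone. -/
def dualMonoid {d : ℕ} (σ : Set (Fin d → ℝ)) : AddSubmonoid (Fin d → ℤ) where
  carrier := {a | ∀ x ∈ σ, 0 ≤ pair a x}
  zero_mem' := by
    intro x _
    simp [pair]
  add_mem' := by
    intro a b ha hb x hx
    have h : pair (a + b) x = pair a x + pair b x := by
      simp [pair, add_mul, Finset.sum_add_distrib]
    rw [h]
    exact add_nonneg (ha x hx) (hb x hx)

/-- The Hilbert basis of a monoid `S` of lattice vectors: the nonzero elements of `S` that are not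
a sum of two nonzero elements of `S`. For `S = (ℤ^d)^∨ ∩ σ^∨` this is `Hilb(σ^∨)`. -/
def hilbertBasis {d : ℕ} (S : AddSubmonoid (Fin d → ℤ)) : Set (Fin d → ℤ) :=
  {a | a ∈ S ∧ a ≠ 0 ∧ ¬ ∃ b ∈ S, ∃ c ∈ S, b ≠ 0 ∧ c ≠ 0 ∧ a = b + c}

/-- The monoid algebra `ℂ[(ℤ^d)^∨ ∩ σ^∨]`. -/
abbrev toricRing {d : ℕ} (σ : Set (Fin d → ℝ)) : Type := AddMonoidAlgebra ℂ (dualMonoid σ)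

/-- The character `e(a)`, `a ∈ (ℤ^d)^∨ ∩ σ^∨`. -/
def character {d : ℕ} (σ : Set (Fin d → ℝ)) (a : dualMonoid σ) : toricRing σ :=
  AddMonoidAlgebra.single a 1

/-- `Spec A` as a scheme over `Spec ℂ`. -/
def specOver (A : Type) [CommRing A] [Algebra ℂ A] : Over (Spec (CommRingCat.of ℂ)) :=
  Over.mk (Spec.map (CommRingCat.ofHom (algebraMap ℂ A)))

/-- The affine toric variety `U_σ = Spec ℂ[(ℤ^d)^∨ ∩ σ^∨]` over `ℂ`. -/
def toricVariety {d : ℕ} (σ : Set (Fin d → ℝ)) : Over (Spec (CommRingCat.of ℂ)) :=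
  specOver (toricRing σ)

/-- The affine space `ℂ^k` as a scheme over `ℂ`. -/
def affineSpaceC (k : ℕ) : Over (Spec (CommRingCat.of ℂ)) :=
  Over.mk (𝔸(Fin k; Spec (CommRingCat.of ℂ)) ↘ Spec (CommRingCat.of ℂ))

/-- `X` is isomorphic over `ℂ` to a closed subscheme of `ℂ^k`. -/
def EmbedsInAffineSpace (X : Over (Spec (CommRingCat.of ℂ))) (k : ℕ) : Prop :=
  ∃ i : X ⟶ affineSpaceC k, IsClosedImmersion i.left

/-- The ideal of the distinguished point `orb(σ)` of `U_σ` for a cone `σ` of full dimension, i.e.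
the point at which the characters `e(a)` with `a ≠ 0` vanish. -/
def orbIdeal {d : ℕ} (σ : Set (Fin d → ℝ)) : Ideal (toricRing σ) :=
  Ideal.span {f | ∃ a : dualMonoid σ, a ≠ 0 ∧ f = character σ a}

/-! ## Nakajima polytopes -/

/-- The points of `ℤ^d` inside `ℝ^d`. -/
def latticePoints (d : ℕ) : Set (Fin d → ℝ) :=
  Set.range fun (a : Fin d → ℤ) (i : Fin d) => (a i : ℝ)

/-- The sublattice `N_P` of `ℤ^d` generated by `aff(P) ∩ ℤ^d`. -/
def latticeOf {d : ℕ} (P : Set (Fin d → ℝ)) : AddSubgroup (Fin d → ℝ) :=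
  AddSubgroup.closure ((affineSpan ℝ P : Set (Fin d → ℝ)) ∩ latticePoints d)

/-- Lattice equivalence `P ∼ Q`: an affine map restricts to a bijection `aff(P) → aff(Q)`, and maps
`P` onto `Q` and `N_P` onto `N_Q`. (Such a map automatically maps the `i`-dimensional faces
of `P` onto those of `Q`.) -/
def LatticeEquiv {d : ℕ} (P Q : Set (Fin d → ℝ)) : Prop :=
  ∃ w : (Fin d → ℝ) →ᵃ[ℝ] (Fin d → ℝ),
    Set.BijOn w (affineSpan ℝ P : Set (Fin d → ℝ)) (affineSpan ℝ Q : Set (Fin d → ℝ)) ∧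
    w '' P = Q ∧
    w '' (latticeOf P : Set (Fin d → ℝ)) = (latticeOf Q : Set (Fin d → ℝ))

/-- The hyperplane `x₁ = 1` of `ℝ^(n+1)`. -/
def hyperplaneOne (n : ℕ) : Set (Fin (n + 1) → ℝ) := {x | x 0 = 1}

/-- For a matrix `m` with rows `m₁, …, m_n` in `(ℤ^(n+1))^∨`, so `d = n + 1`: the polytope
`P_m^(k+1)`, given by `P^(1) = {e₁}` and
`P^(k+1) = conv(P^(k) ∪ {(x', ⟨m_k, x⟩, 0, …, 0) | x = (x', 0, …, 0) ∈ P^(k)})`.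
(With indices starting from `0`, the new coordinate belonging to row `k` is `k.succ`.) -/
def stage {n : ℕ} (m : Fin n → Fin (n + 1) → ℤ) (k : Fin (n + 1)) : Set (Fin (n + 1) → ℝ) :=
  Fin.induction (motive := fun _ => Set (Fin (n + 1) → ℝ)) {Pi.single 0 1}
    (fun k P => convexHull ℝ (P ∪ (fun x => Function.update x k.succ (pair (m k) x)) '' P)) k

/-- The polytope `P_m^(d)`, `d = n + 1`. -/
def nakajimaPolytope {n : ℕ} (m : Fin n → Fin (n + 1) → ℤ) : Set (Fin (n + 1) → ℝ) :=
  stage m (Fin.last n)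

/-- Admissible sequences of free parameters of length `n = d - 1` with respect to `ℤ^d`. -/
structure IsAdmissible {n : ℕ} (m : Fin n → Fin (n + 1) → ℤ) : Prop where
  /-- The rows are nonzero. -/
  ne_zero : ∀ i, m i ≠ 0
  /-- `m_{i,j} = 0` for `i < j`. -/
  lower : ∀ (i : Fin n) (j : Fin (n + 1)), (i : ℕ) < (j : ℕ) → m i j = 0
  /-- The row that is used to construct the next polytope is non-negative on the current one. -/
  nonneg : ∀ k : Fin n, ∀ x ∈ stage m k.castSucc, 0 ≤ pair (m k) x

/-- The cone `τ_{P_m^(d)}`. -/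
def nakajimaCone {n : ℕ} (m : Fin n → Fin (n + 1) → ℤ) : Set (Fin (n + 1) → ℝ) :=
  coneOver (nakajimaPolytope m)

/-! ## The binomials

In terms of indices starting from `1`, `lam m j c` is `λ_{c-1,j}` and `mu m j c` is `μ_{c-1,j}`,
so that `lam m j r.succ` is `λ_{r,j}`. -/

/-- The exponents `λ`, by descending recursion on `c`: in indices starting from `1`,
`λ_{i,j} = min(0, m_{j,i+1} + ∑_{k=i+1}^{j-1} m_{k,i+1} λ_{k,j})` for `1 ≤ i ≤ j-1`
and `λ_{0,j} = 0`. -/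
def lam {n : ℕ} (m : Fin n → Fin (n + 1) → ℤ) (j : Fin n) (c : Fin (n + 1)) : ℤ :=
  if c = 0 then 0
  else min 0 (m j c +
    ∑ r : {r : Fin n // c ≤ r.castSucc ∧ r < j}, m r.1 c * lam m j r.1.succ)
termination_by n - (c : ℕ)
decreasing_by
  have h1 := r.2.1
  have h2 := r.1.2
  rw [Fin.le_def] at h1
  simp only [Fin.val_castSucc] at h1
  simp only [Fin.val_succ]
  omega

/-- The exponents `μ`: in indices starting from `1`,
`μ_{i,j} = max(0, m_{j,i+1} + ∑_{k=i+1}^{j-1} m_{k,i+1} λ_{k,j})` for `1 ≤ i ≤ j-1`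
and `μ_{0,j} = m_{j,1} + ∑_{k=1}^{j-1} m_{k,1} λ_{k,j}`. -/
def mu {n : ℕ} (m : Fin n → Fin (n + 1) → ℤ) (j : Fin n) (c : Fin (n + 1)) : ℤ :=
  let s := m j c + ∑ r : {r : Fin n // c ≤ r.castSucc ∧ r < j}, m r.1 c * lam m j r.1.succ
  if c = 0 then s else max 0 s

/-- The `2d - 1` variables: `Sum.inl k` stands for `z₁, …, z_d` and `Sum.inr l` for
`z_{d+1}, …, z_{2d-1}`. -/
abbrev Var (n : ℕ) : Type := Fin (n + 1) ⊕ Fin n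

/-- The binomial `∏_{1 ≤ i ≤ j} z_i^{μ_{i-1,j}} z_{d+i-1}^{-λ_{i-1,j}} - z_{j+1} z_{d+j}`. The factor
`z_{d+i-1}^{-λ_{i-1,j}}` with `i = 1` is `1` because `λ_{0,j} = 0`. -/
def binomial {n : ℕ} (m : Fin n → Fin (n + 1) → ℤ) (j : Fin n) : MvPolynomial (Var n) ℂ :=
  (∏ c ∈ Finset.Iic j.castSucc, MvPolynomial.X (Sum.inl c) ^ (mu m j c).toNat) *
    (∏ r ∈ Finset.Iio j, MvPolynomial.X (Sum.inr r) ^ (-lam m j r.succ).toNat) -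
    MvPolynomial.X (Sum.inl j.succ) * MvPolynomial.X (Sum.inr j)

/-- The dual lattice vectors to which the variables correspond: `z_k` to `e_k^∨` and `z_{d+l}` to
`m_l - e_{l+1}^∨`. -/
def vec {n : ℕ} (m : Fin n → Fin (n + 1) → ℤ) : Var n → Fin (n + 1) → ℤ
  | Sum.inl k => Pi.single k 1
  | Sum.inr l => m l - Pi.single l.succ 1

/-! ## Elimination of the redundant variables -/

/-- The set `𝔔_m`: the `k` with `e_k^∨ = m_γ` for some `γ ∈ {k, …, d-1}`. (There is no such `γ` for
`k = d`.) -/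
def setQ {n : ℕ} (m : Fin n → Fin (n + 1) → ℤ) : Set (Fin (n + 1)) :=
  {k | ∃ g : Fin n, k ≤ g.castSucc ∧ Pi.single k 1 = m g}

/-- The set `ℜ_m`: the `l` with `m_l - e_{l+1}^∨ = m_δ` for some `δ ∈ {l+1, …, d-1}`. (There is no
such `δ` for `l = d-1`.) -/
def setR {n : ℕ} (m : Fin n → Fin (n + 1) → ℤ) : Set (Fin n) :=
  {l | ∃ g : Fin n, l < g ∧ m l - Pi.single l.succ 1 = m g}

/-- `γ` and `δ` are choices of the indices `γ_k`, `k ∈ 𝔔_m`, and `δ_l`, `l ∈ ℜ_m`; their values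
elsewhere are irrelevant. -/
structure IsIndexChoice {n : ℕ} (m : Fin n → Fin (n + 1) → ℤ) (γ : Fin (n + 1) → Fin n)
    (δ : Fin n → Fin n) : Prop where
  /-- `k ≤ γ_k` and `e_k^∨ = m_{γ_k}`. -/
  gamma_spec : ∀ k ∈ setQ m, k ≤ (γ k).castSucc ∧ Pi.single k 1 = m (γ k)
  /-- `l < δ_l` and `m_l - e_{l+1}^∨ = m_{δ_l}`. -/
  delta_spec : ∀ l ∈ setR m, l < δ l ∧ m l - Pi.single l.succ 1 = m (δ l)

/-- The variables `z_k`, `k ∉ 𝔔_m`, and `z_{d+l}`, `l ∉ ℜ_m`. -/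
abbrev RemVar {n : ℕ} (m : Fin n → Fin (n + 1) → ℤ) : Type :=
  {k : Fin (n + 1) // k ∉ setQ m} ⊕ {l : Fin n // l ∉ setR m}

/-- The remaining variables among all variables. -/
def RemVar.toVar {n : ℕ} {m : Fin n → Fin (n + 1) → ℤ} : RemVar m → Var n :=
  Sum.map Subtype.val Subtype.val

open scoped Classical in
/-- The value of a variable after the (iterated) substitutions `z_k = z_{γ_k+1} z_{d+γ_k}`,
`k ∈ 𝔔_m`, and `z_{d+l} = z_{δ_l+1} z_{d+δ_l}`, `l ∈ ℜ_m`, are carried out until no variable that is to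
be eliminated is left. -/
def elimVar {n : ℕ} {m : Fin n → Fin (n + 1) → ℤ} {γ : Fin (n + 1) → Fin n} {δ : Fin n → Fin n}
    (hc : IsIndexChoice m γ δ) : Var n → MvPolynomial (RemVar m) ℂ
  | Sum.inl k =>
      if h : k ∈ setQ m then
        elimVar hc (Sum.inl (γ k).succ) * elimVar hc (Sum.inr (γ k))
      else MvPolynomial.X (Sum.inl ⟨k, h⟩)
  | Sum.inr l =>
      if h : l ∈ setR m then
        elimVar hc (Sum.inl (δ l).succ) * elimVar hc (Sum.inr (δ l))
      else MvPolynomial.X (Sum.inr ⟨l, h⟩)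
termination_by v => 2 * (n + 1) - Sum.elim (fun k : Fin (n + 1) => 2 * (k : ℕ)) (fun l : Fin n => 2 * (l : ℕ) + 1) v
decreasing_by
  all_goals
    first
    | have h1 := (hc.gamma_spec k h).1
      rw [Fin.le_def, Fin.val_castSucc] at h1
      have _ := (γ k).2
      simp only [Sum.elim_inl, Sum.elim_inr, Fin.val_succ]
      omega
    | have h1 := (hc.delta_spec l h).1
      rw [Fin.lt_def] at h1
      have _ := (δ l).2
      simp only [Sum.elim_inl, Sum.elim_inr, Fin.val_succ]
      omega

/-- The elimination homomorphism `ℂ[z₁, …, z_{2d-1}] → ℂ[remaining variables]`. -/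
def elim {n : ℕ} {m : Fin n → Fin (n + 1) → ℤ} {γ : Fin (n + 1) → Fin n} {δ : Fin n → Fin n}
    (hc : IsIndexChoice m γ δ) : MvPolynomial (Var n) ℂ →ₐ[ℂ] MvPolynomial (RemVar m) ℂ :=
  MvPolynomial.aeval (elimVar hc)

/-- The binomials that remain: those not used for a substitution, after the elimination. -/
def remainingBinomials {n : ℕ} {m : Fin n → Fin (n + 1) → ℤ} {γ : Fin (n + 1) → Fin n}
    {δ : Fin n → Fin n} (hc : IsIndexChoice m γ δ) : Set (MvPolynomial (RemVar m) ℂ) :=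
  (fun j => elim hc (binomial m j)) '' {j : Fin n | j ∉ γ '' setQ m ∧ j ∉ δ '' setR m}

/-- A polynomial of the form `(monomial) - (monomial)` with two different monomials. -/
def IsBinomial {σ : Type} (p : MvPolynomial σ ℂ) : Prop :=
  ∃ a b : σ →₀ ℕ, a ≠ b ∧ p = MvPolynomial.monomial a 1 - MvPolynomial.monomial b 1

/-- The ideal generated by the remaining binomials. -/
def remainingIdeal {n : ℕ} {m : Fin n → Fin (n + 1) → ℤ} {γ : Fin (n + 1) → Fin n}
    {δ : Fin n → Fin n} (hc : IsIndexChoice m γ δ) : Ideal (MvPolynomial (RemVar m) ℂ) :=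
  Ideal.span (remainingBinomials hc)

end ToricLCI

end

/-!
The dual cone of `τ` is cut out by the facets of the Nakajima polytope: the points of `P_m^(d)` are
those with `x_1 = 1` and `0 ≤ x_{k+1} ≤ ⟨m_k, x⟩`, so the monoid `S = (ℤ^d)^∨ ∩ τ^∨` is generated
by the `e_k^∨` and the `m_l - e_{l+1}^∨`. This is proved by removing the coordinates of `a ∈ S`
from the top (`mem_closure_of_stage`). The same descent for `a = m_j` yields the exponents `λ`,
`μ` and their signs (`reducedRow_nonneg`, `mu_nonneg`).

Call a monomial in the `2d - 1` variables normal if no `z_{l+1} z_{d+l}` divides it. A normal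
monomial is determined by its covector in `S` (`IsNormal.ext`), and since the first monomial of
`f_j` is normal, with covector `m_j`, replacing `z_{j+1} z_{d+j}` by it turns every monomial into
a normal one; this stops because a suitable grading decreases (`exists_degree_lt`). Hence two
monomials with the same covector are congruent modulo the `f_j`, that is, the `f_j` generate the
kernel of `ℂ[z_1, …, z_{2d-1}] → ℂ[S]` (`ker_evalVec`). The last replacement on the way to a
single variable `z_v` shows that the covector of `v` is reducible in `S` precisely when it is one
of the rows `m_j` (`exists_row_eq_vec`). These are the variables indexed by `𝔔` and `ℜ`, so the
remaining ones correspond to the Hilbert basis (`bijOn_vec`).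

If `m_j` is the covector of `v`, then `f_j = z_v - z_{j+1} z_{d+j}`, so the elimination kills
`f_j` and does not change classes modulo the `f_j`; this gives the presentation (`ker_evalRem`).
On exponents the elimination is the quotient by the differences of the monomials of the
eliminating `f_j`. As the differences for all `f_j` are linearly independent
(`linearIndependent_relation`), the remaining binomials do not vanish and are pairwise distinct.

For the embedding dimension, the characters of the Hilbert basis generate the maximal ideal of the
fixed point, and no fewer elements do, even locally: sending them to the basis of `ℂ^Hilb` and all
other `e(a)`, `a ≠ 0`, to zero defines a ring homomorphism to the square-zero extension of `ℂ` by
`ℂ^Hilb` (`linearPart`, `card_le_spanFinrank`). Finally, an affine lattice equivalence between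
polytopes spanning the hyperplane `x_1 = 1` extends to a linear automorphism of `ℤ^d`
(`LatticeEquiv.nonempty_dualMonoid_equiv`).
-/

namespace ToricLCI

/-! ### The dual monoid of a Nakajima cone -/

section Pairing

variable {d : ℕ}

/-- `x ↦ ⟨a, x⟩` for a real covector `a`, as a linear form. -/
def realPair (a : Fin d → ℝ) : (Fin d → ℝ) →ₗ[ℝ] ℝ := ∑ i, a i • LinearMap.proj i

lemma realPair_apply (a x : Fin d → ℝ) : realPair a x = ∑ i, a i * x i := by
  simp [realPair]

lemma pair_eq_realPair (a : Fin d → ℤ) (x : Fin d → ℝ) :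
    pair a x = realPair (fun i => (a i : ℝ)) x := by
  simp [pair, realPair_apply]

lemma pair_add (a b : Fin d → ℤ) (x : Fin d → ℝ) : pair (a + b) x = pair a x + pair b x := by
  simp [pair, add_mul, Finset.sum_add_distrib]

lemma pair_sub (a b : Fin d → ℤ) (x : Fin d → ℝ) : pair (a - b) x = pair a x - pair b x := by
  simp [pair, sub_mul, Finset.sum_sub_distrib]

lemma pair_zsmul (c : ℤ) (a : Fin d → ℤ) (x : Fin d → ℝ) : pair (c • a) x = c * pair a x := by
  simp [pair, Finset.mul_sum, mul_assoc]

lemma pair_single (k : Fin d) (x : Fin d → ℝ) : pair (Pi.single k 1) x = x k := by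
  simp [pair, Pi.single_apply]

lemma pair_smul (a : Fin d → ℤ) (c : ℝ) (x : Fin d → ℝ) : pair a (c • x) = c * pair a x := by
  simp only [pair_eq_realPair, map_smul, smul_eq_mul]

lemma realPair_update (a x : Fin d → ℝ) (k : Fin d) (t : ℝ) :
    realPair a (Function.update x k t) = realPair a x + a k * (t - x k) := by
  have h : Function.update x k t = x + Pi.single k (t - x k) := by
    ext i
    by_cases hi : i = k
    · subst hi; simp
    · simp [hi]
  rw [h, map_add]
  simp [realPair_apply, Pi.single_apply]

lemma pair_update (a : Fin d → ℤ) (x : Fin d → ℝ) (k : Fin d) (t : ℝ) :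
    pair a (Function.update x k t) = pair a x + a k * (t - x k) := by
  simp only [pair_eq_realPair, realPair_update]

lemma convex_pair_nonneg (a : Fin d → ℤ) : Convex ℝ {x | 0 ≤ pair a x} := by
  have h : {x | 0 ≤ pair a x} = {x | 0 ≤ realPair (fun i => (a i : ℝ)) x} := by
    ext x; simp [pair_eq_realPair]
  rw [h]
  exact convex_halfSpace_ge (realPair _).isLinear 0

lemma mem_dualMonoid_coneOver {P : Set (Fin d → ℝ)} {a : Fin d → ℤ} :
    a ∈ dualMonoid (coneOver P) ↔ ∀ x ∈ P, 0 ≤ pair a x := by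
  constructor
  · intro h x hx
    exact h x ⟨1, zero_le_one, x, hx, (one_smul _ _).symm⟩
  · rintro h y ⟨κ, hκ, x, hx, rfl⟩
    rw [pair_smul]
    exact mul_nonneg hκ (h x hx)

end Pairing

variable {n : ℕ} {m : Fin n → Fin (n + 1) → ℤ}

lemma stage_zero (m : Fin n → Fin (n + 1) → ℤ) : stage m 0 = {Pi.single 0 1} := rfl

lemma stage_succ (m : Fin n → Fin (n + 1) → ℤ) (k : Fin n) :
    stage m k.succ = convexHull ℝ (stage m k.castSucc ∪
      (fun x => Function.update x k.succ (pair (m k) x)) '' stage m k.castSucc) := by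
  unfold stage
  rw [Fin.induction_succ]

lemma stage_castSucc_subset (m : Fin n → Fin (n + 1) → ℤ) (k : Fin n) :
    stage m k.castSucc ⊆ stage m k.succ := by
  rw [stage_succ]
  exact Set.subset_union_left.trans (subset_convexHull ℝ _)

lemma update_mem_stage_succ {k : Fin n} {x : Fin (n + 1) → ℝ} (hx : x ∈ stage m k.castSucc) :
    Function.update x k.succ (pair (m k) x) ∈ stage m k.succ := by
  rw [stage_succ]
  exact subset_convexHull ℝ _ (Or.inr ⟨x, hx, rfl⟩)

lemma stage_succ_subset {k : Fin n} {C : Set (Fin (n + 1) → ℝ)} (hC : Convex ℝ C)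
    (h : ∀ x ∈ stage m k.castSucc, x ∈ C ∧ Function.update x k.succ (pair (m k) x) ∈ C) :
    stage m k.succ ⊆ C := by
  rw [stage_succ]
  refine convexHull_min ?_ hC
  rintro y (hy | ⟨x, hx, rfl⟩)
  · exact (h y hy).1
  · exact (h x hx).2

lemma pair_nonneg_on_stage_succ {k : Fin n} {a : Fin (n + 1) → ℤ}
    (h : ∀ x ∈ stage m k.castSucc, 0 ≤ pair a x ∧
      0 ≤ pair a (Function.update x k.succ (pair (m k) x))) :
    ∀ x ∈ stage m k.succ, 0 ≤ pair a x :=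
  fun _ hx => stage_succ_subset (convex_pair_nonneg a) (fun y hy => h y hy) hx

/-- The polytope `P^(k+1)` lies in the coordinate subspace of the first `k + 1` coordinates. -/
lemma apply_eq_zero_of_mem_stage {k : Fin (n + 1)} {x : Fin (n + 1) → ℝ} (hx : x ∈ stage m k)
    {i : Fin (n + 1)} (hi : k < i) : x i = 0 := by
  induction k using Fin.induction generalizing x with
  | zero =>
    rw [stage_zero, Set.mem_singleton_iff] at hx
    subst hx
    simp [hi.ne']
  | succ k ih =>
    have hC : Convex ℝ {x : Fin (n + 1) → ℝ | x i = 0} :=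
      convex_hyperplane (LinearMap.proj (R := ℝ) (φ := fun _ : Fin (n + 1) => ℝ) i).isLinear 0
    refine stage_succ_subset hC (fun y hy => ?_) hx
    have h0 := ih hy (k.castSucc_lt_succ.trans hi)
    exact ⟨h0, by simpa [Function.update_of_ne hi.ne'] using h0⟩

lemma apply_zero_of_mem_stage {k : Fin (n + 1)} {x : Fin (n + 1) → ℝ} (hx : x ∈ stage m k) :
    x 0 = 1 := by
  induction k using Fin.induction generalizing x with
  | zero =>
    rw [stage_zero, Set.mem_singleton_iff] at hx
    subst hx
    simp
  | succ k ih =>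
    have hC : Convex ℝ {x : Fin (n + 1) → ℝ | x 0 = 1} :=
      convex_hyperplane (LinearMap.proj (R := ℝ) (φ := fun _ : Fin (n + 1) => ℝ) 0).isLinear 1
    refine stage_succ_subset hC (fun y hy => ?_) hx
    have h0 := ih hy
    exact ⟨h0, by simpa [Function.update_of_ne (Fin.succ_ne_zero k).symm] using h0⟩

/-- A covector that only involves the coordinates of `P^(k+1)` and is non-negative there is
non-negative on the whole polytope. -/
lemma pair_nonneg_of_stage {a : Fin (n + 1) → ℤ} {k l : Fin (n + 1)} (hkl : k ≤ l)
    (hsupp : ∀ i, k < i → a i = 0) (h : ∀ x ∈ stage m k, 0 ≤ pair a x) :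
    ∀ x ∈ stage m l, 0 ≤ pair a x := by
  induction l using Fin.induction with
  | zero =>
    have : k = 0 := by simpa using hkl
    subst this
    exact h
  | succ l ih =>
    rcases hkl.eq_or_lt with rfl | hlt
    · exact h
    · have hkl' : k ≤ l.castSucc := Fin.le_castSucc_iff.2 hlt
      refine pair_nonneg_on_stage_succ fun y hy => ?_
      have h0 := ih hkl' y hy
      refine ⟨h0, ?_⟩
      rw [pair_update, hsupp _ hlt]
      simpa using h0

lemma mem_dualMonoid_of_stage {a : Fin (n + 1) → ℤ} (k : Fin (n + 1))
    (hsupp : ∀ i, k < i → a i = 0) (h : ∀ x ∈ stage m k, 0 ≤ pair a x) :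
    a ∈ dualMonoid (nakajimaCone m) :=
  mem_dualMonoid_coneOver.2 (pair_nonneg_of_stage (Fin.le_last k) hsupp h)

lemma apply_nonneg_of_mem_stage (hm : IsAdmissible m) (i k : Fin (n + 1)) {x : Fin (n + 1) → ℝ}
    (hx : x ∈ stage m k) : 0 ≤ x i := by
  induction k using Fin.induction generalizing x with
  | zero =>
    rw [stage_zero, Set.mem_singleton_iff] at hx
    subst hx
    by_cases h : i = 0
    · subst h; simp
    · simp [h]
  | succ k ih =>
    have hC : Convex ℝ {x : Fin (n + 1) → ℝ | 0 ≤ x i} :=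
      convex_halfSpace_ge (LinearMap.proj (R := ℝ) (φ := fun _ : Fin (n + 1) => ℝ) i).isLinear 0
    refine stage_succ_subset hC (fun y hy => ⟨ih hy, ?_⟩) hx
    by_cases h : i = k.succ
    · subst h
      simpa using hm.nonneg k y hy
    · simpa [Function.update_of_ne h] using ih hy

lemma row_apply_eq_zero (hm : IsAdmissible m) {k : Fin n} {i : Fin (n + 1)}
    (h : k.castSucc < i) : m k i = 0 :=
  hm.lower k i (by simpa [Fin.lt_def] using h)

/-- The vectors of all the variables lie in the dual monoid: they are the facet inequalities
`0 ≤ x_k` and `x_{l+1} ≤ ⟨m_l, x⟩`. -/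
lemma vec_mem (hm : IsAdmissible m) (v : Var n) : vec m v ∈ dualMonoid (nakajimaCone m) := by
  rcases v with k | l
  · refine mem_dualMonoid_coneOver.2 fun x hx => ?_
    simp only [vec, pair_single]
    exact apply_nonneg_of_mem_stage hm k _ hx
  · refine mem_dualMonoid_of_stage l.succ (fun i hi => ?_) ?_
    · simp [vec, row_apply_eq_zero hm (l.castSucc_lt_succ.trans hi), hi.ne']
    · refine pair_nonneg_on_stage_succ fun y hy => ?_
      have h1 := hm.nonneg l y hy
      have h2 := apply_eq_zero_of_mem_stage hy l.castSucc_lt_succ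
      have h3 := row_apply_eq_zero hm l.castSucc_lt_succ
      simpa [vec, pair_sub, pair_single, pair_update, h2, h3] using h1

/-- The dual monoid is generated by the vectors of the variables. The top coordinate `c` of a
covector is removed by subtracting `c e_{k+1}^∨` if `c ≥ 0` and `-c (m_k - e_{k+1}^∨)` otherwise;
the rest is non-negative on the preceding polytope. -/
lemma mem_closure_of_stage (m : Fin n → Fin (n + 1) → ℤ) (hm : IsAdmissible m) (k : Fin (n + 1))
    {a : Fin (n + 1) → ℤ} (hsupp : ∀ i, k < i → a i = 0)
    (h : ∀ x ∈ stage m k, 0 ≤ pair a x) : a ∈ AddSubmonoid.closure (Set.range (vec m)) := by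
  have key : ∀ (c : ℤ) (v : Var n), 0 ≤ c →
      c • vec m v ∈ AddSubmonoid.closure (Set.range (vec m)) := by
    intro c v hc
    lift c to ℕ using hc
    rw [natCast_zsmul]
    exact nsmul_mem (AddSubmonoid.subset_closure (Set.mem_range_self v)) c
  induction k using Fin.induction generalizing a with
  | zero =>
    have h0 : 0 ≤ a 0 := by
      have := h (Pi.single 0 1) (by simp [stage_zero])
      have h1 : pair a (Pi.single 0 1) = a 0 := by simp [pair, Pi.single_apply]
      rw [h1] at this
      exact_mod_cast this
    have ha : a = a 0 • vec m (Sum.inl 0) := by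
      ext i
      by_cases hi : i = 0
      · subst hi; simp [vec]
      · simp [vec, hi, hsupp i (Fin.pos_of_ne_zero hi)]
    rw [ha]
    exact key _ _ h0
  | succ k ih =>
    have hsplit : ∀ (b : Fin (n + 1) → ℤ), b k.succ = a k.succ → (∀ i, k.succ < i → b i = 0) →
        ∀ i, k.castSucc < i → (a - b) i = 0 := by
      intro b hb hb' i hi
      rcases (Fin.castSucc_lt_iff_succ_le.1 hi).eq_or_lt with rfl | hlt
      · simp [hb]
      · simp [hb' i hlt, hsupp i hlt]
    rcases le_total 0 (a k.succ) with hpos | hneg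
    · have h1 : a - a k.succ • vec m (Sum.inl k.succ) ∈
          AddSubmonoid.closure (Set.range (vec m)) := by
        refine ih (hsplit _ (by simp [vec]) fun i hi => by simp [vec, hi.ne']) fun x hx => ?_
        have h2 := h x (stage_castSucc_subset m k hx)
        rw [pair_sub, pair_zsmul]
        simpa [vec, pair_single, apply_eq_zero_of_mem_stage hx k.castSucc_lt_succ] using h2
      simpa using add_mem h1 (key _ (Sum.inl k.succ) hpos)
    · have h1 : a - (-a k.succ) • vec m (Sum.inr k) ∈
          AddSubmonoid.closure (Set.range (vec m)) := by
        refine ih (hsplit _ ?_ fun i hi => ?_) fun x hx => ?_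
        · simp [vec, row_apply_eq_zero hm k.castSucc_lt_succ]
        · simp [vec, row_apply_eq_zero hm (k.castSucc_lt_succ.trans hi), hi.ne']
        · have h2 := h _ (update_mem_stage_succ hx)
          rw [pair_update, apply_eq_zero_of_mem_stage hx k.castSucc_lt_succ] at h2
          rw [pair_sub, pair_zsmul]
          simp only [vec, pair_sub, pair_single,
            apply_eq_zero_of_mem_stage hx k.castSucc_lt_succ]
          push_cast
          linarith
      simpa using add_mem h1 (key _ (Sum.inr k) (neg_nonneg.2 hneg))

lemma mem_closure_range_vec (hm : IsAdmissible m) {a : Fin (n + 1) → ℤ}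
    (ha : a ∈ dualMonoid (nakajimaCone m)) : a ∈ AddSubmonoid.closure (Set.range (vec m)) :=
  mem_closure_of_stage m hm (Fin.last n) (fun i hi => absurd hi (Fin.le_last i).not_gt)
    (mem_dualMonoid_coneOver.1 ha)

/-- Since the rows `m_k` do not vanish, the polytope `P^(k+1)` spans the space of the first `k + 1`
coordinates: no non-zero linear form in these coordinates vanishes on it. -/
lemma eq_zero_of_realPair_stage (hm : IsAdmissible m) (k : Fin (n + 1)) {a : Fin (n + 1) → ℝ}
    (hsupp : ∀ i, k < i → a i = 0) (h : ∀ x ∈ stage m k, realPair a x = 0) : a = 0 := by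
  induction k using Fin.induction generalizing a with
  | zero =>
    ext i
    by_cases hi : i = 0
    · subst hi
      have := h (Pi.single 0 1) (by simp [stage_zero])
      simpa [realPair_apply, Pi.single_apply] using this
    · simpa using hsupp i (Fin.pos_of_ne_zero hi)
  | succ k ih =>
    have h0 : ∀ x ∈ stage m k.castSucc, realPair a x = 0 :=
      fun x hx => h x (stage_castSucc_subset m k hx)
    have htop : a k.succ = 0 := by
      by_contra hne
      have hrow : (fun i => (m k i : ℝ)) = 0 := by
        refine ih (fun i hi => by simp [row_apply_eq_zero hm hi]) fun x hx => ?_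
        have h1 := h _ (update_mem_stage_succ hx)
        rw [realPair_update, h0 x hx, apply_eq_zero_of_mem_stage hx k.castSucc_lt_succ] at h1
        rw [← pair_eq_realPair]
        simpa [hne] using h1
      refine hm.ne_zero k (funext fun i => ?_)
      have := congrFun hrow i
      simpa using this
    refine ih (fun i hi => ?_) h0
    rcases (Fin.castSucc_lt_iff_succ_le.1 hi).eq_or_lt with rfl | hlt
    · exact htop
    · exact hsupp i hlt

lemma span_nakajimaPolytope (hm : IsAdmissible m) :
    Submodule.span ℝ (nakajimaPolytope m) = ⊤ := by
  by_contra hne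
  obtain ⟨f, hf, hf'⟩ := Submodule.exists_le_ker_of_lt_top _ (lt_top_iff_ne_top.2 hne)
  have hfa : f = realPair (fun i => f (Pi.single i 1)) := by
    refine LinearMap.pi_ext' fun i => LinearMap.ext_ring ?_
    simp [realPair_apply, Pi.single_apply]
  have h0 : (fun i => f (Pi.single i 1)) = 0 := by
    refine eq_zero_of_realPair_stage hm (Fin.last n)
      (fun i hi => absurd hi (Fin.le_last i).not_gt) fun x hx => ?_
    rw [← hfa]
    exact hf' (Submodule.subset_span hx)
  refine hf (LinearMap.pi_ext' fun i => LinearMap.ext_ring ?_)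
  simpa using congrFun h0 i

/-- The dual monoid contains no line. -/
lemma eq_zero_of_add_eq_zero (hm : IsAdmissible m) {a b : Fin (n + 1) → ℤ}
    (ha : a ∈ dualMonoid (nakajimaCone m)) (hb : b ∈ dualMonoid (nakajimaCone m))
    (hab : a + b = 0) : a = 0 := by
  have h0 : (fun i => (a i : ℝ)) = 0 := by
    refine eq_zero_of_realPair_stage hm (Fin.last n)
      (fun i hi => absurd hi (Fin.le_last i).not_gt) fun x hx => ?_
    have h1 := mem_dualMonoid_coneOver.1 ha x hx
    have h2 := mem_dualMonoid_coneOver.1 hb x hx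
    have h3 : pair a x + pair b x = 0 := by
      rw [← pair_add, hab]
      simp [pair]
    rw [← pair_eq_realPair]
    linarith
  ext i
  have := congrFun h0 i
  simpa using this

/-! ### The exponents of the binomials -/

/-- The covector `m_j + ∑ λ_{r,j} m_r`, the sum over the rows with `i ≤ r < j`, where rows are
counted from `0`. Its coordinate `i` is the quantity whose minimum and maximum with `0` are the
exponents `lam m j i` and `mu m j i`, for `i ≠ 0`. -/
def reducedRow (m : Fin n → Fin (n + 1) → ℤ) (j : Fin n) (i : Fin (n + 1)) : Fin (n + 1) → ℤ :=
  m j + ∑ r : Fin n with i ≤ r.castSucc ∧ r < j, lam m j r.succ • m r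

lemma reducedRow_apply_self (m : Fin n → Fin (n + 1) → ℤ) (j : Fin n) (c : Fin (n + 1)) :
    reducedRow m j c c = m j c +
      ∑ r : {r : Fin n // c ≤ r.castSucc ∧ r < j}, m r.1 c * lam m j r.1.succ := by
  simp only [reducedRow, Pi.add_apply, Finset.sum_apply, Pi.smul_apply, smul_eq_mul]
  congr 1
  rw [Finset.sum_subtype (p := fun r : Fin n => c ≤ r.castSucc ∧ r < j) _ (by simp)]
  exact Finset.sum_congr rfl fun r _ => mul_comm _ _

lemma lam_eq (m : Fin n → Fin (n + 1) → ℤ) (j : Fin n) (c : Fin (n + 1)) :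
    lam m j c = if c = 0 then 0 else min 0 (reducedRow m j c c) := by
  rw [reducedRow_apply_self, lam]

lemma mu_eq (m : Fin n → Fin (n + 1) → ℤ) (j : Fin n) (c : Fin (n + 1)) :
    mu m j c = if c = 0 then reducedRow m j c c else max 0 (reducedRow m j c c) := by
  rw [reducedRow_apply_self, mu]

lemma lam_nonpos (m : Fin n → Fin (n + 1) → ℤ) (j : Fin n) (c : Fin (n + 1)) :
    lam m j c ≤ 0 := by
  rw [lam_eq]
  split_ifs
  · exact le_rfl
  · exact min_le_left _ _

lemma mu_add_lam (hm : IsAdmissible m) (j : Fin n) (c : Fin (n + 1)) :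
    mu m j c + lam m j c = m j c + ∑ r ∈ Finset.Iio j, lam m j r.succ * m r c := by
  have h1 : mu m j c + lam m j c = reducedRow m j c c := by
    rw [lam_eq, mu_eq]
    split_ifs
    · simp
    · exact max_add_min _ _ |>.trans (zero_add _)
  rw [h1]
  simp only [reducedRow, Pi.add_apply, Finset.sum_apply, Pi.smul_apply, smul_eq_mul]
  congr 1
  refine Finset.sum_subset (fun r hr => by simpa using (Finset.mem_filter.1 hr).2.2)
    fun r hr hr' => ?_
  have : r.castSucc < c := by
    by_contra hlt
    exact hr' (by simpa using ⟨not_lt.1 hlt, by simpa using hr⟩)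
  rw [row_apply_eq_zero hm this, mul_zero]

lemma mu_succ_eq_zero_or (m : Fin n → Fin (n + 1) → ℤ) (j l : Fin n) :
    mu m j l.succ = 0 ∨ lam m j l.succ = 0 := by
  rw [lam_eq, mu_eq, if_neg (Fin.succ_ne_zero l), if_neg (Fin.succ_ne_zero l)]
  rcases le_total 0 (reducedRow m j l.succ l.succ) with h | h
  · exact Or.inr (min_eq_left h)
  · exact Or.inl (max_eq_left h)

/-- Adding `λ_{c,j} m_c` keeps the covector non-negative on the smaller polytope `P^(c)`: if
`λ_{c,j}` is negative, evaluate at the point over `x` on the upper facet `x_{c+1} = ⟨m_c, x⟩`. -/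
lemma reducedRow_nonneg (hm : IsAdmissible m) (j : Fin n) (i : Fin (n + 1))
    (hi : i ≤ j.castSucc) : ∀ x ∈ stage m i, 0 ≤ pair (reducedRow m j i) x := by
  induction i using Fin.reverseInduction with
  | last => exact absurd hi (Fin.castSucc_lt_last j).not_ge
  | cast c ih =>
    rcases hi.eq_or_lt with heq | hlt
    · have hcj : c = j := Fin.castSucc_injective _ heq
      subst hcj
      have h0 : reducedRow m c c.castSucc = m c := by
        have he : (Finset.univ.filter fun r : Fin n => c.castSucc ≤ r.castSucc ∧ r < c) = ∅ :=
          Finset.filter_eq_empty_iff.2 fun r _ hr =>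
            (Fin.castSucc_le_castSucc_iff.1 hr.1).not_gt hr.2
        rw [reducedRow, he, Finset.sum_empty, add_zero]
      rw [h0]
      exact hm.nonneg c
    · have hcj : c < j := Fin.castSucc_lt_castSucc_iff.1 hlt
      have h0 : reducedRow m j c.castSucc = reducedRow m j c.succ + lam m j c.succ • m c := by
        have he : (Finset.univ.filter fun r : Fin n => c.castSucc ≤ r.castSucc ∧ r < j) =
            insert c (Finset.univ.filter fun r : Fin n => c.succ ≤ r.castSucc ∧ r < j) := by
          ext r
          simp only [Finset.mem_filter, Finset.mem_univ, true_and, Finset.mem_insert, Fin.le_def,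
            Fin.lt_def, Fin.ext_iff, Fin.val_castSucc, Fin.val_succ] at hcj ⊢
          omega
        rw [reducedRow, he, Finset.sum_insert, reducedRow]
        · abel
        · simp [Fin.le_def]
      intro x hx
      have ih' := ih (Fin.castSucc_lt_iff_succ_le.1 hlt)
      have h1 := ih' x (stage_castSucc_subset m c hx)
      have h2 := ih' _ (update_mem_stage_succ hx)
      rw [pair_update, apply_eq_zero_of_mem_stage hx c.castSucc_lt_succ] at h2
      rw [h0, pair_add, pair_zsmul, lam_eq, if_neg (Fin.succ_ne_zero c)]
      rcases le_total 0 (reducedRow m j c.succ c.succ) with h | h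
      · rw [min_eq_left h]
        simpa using h1
      · rw [min_eq_right h]
        linarith

lemma mu_nonneg (hm : IsAdmissible m) (j : Fin n) (c : Fin (n + 1)) : 0 ≤ mu m j c := by
  rw [mu_eq]
  split_ifs with h
  · subst h
    have h1 := reducedRow_nonneg hm j 0 (Fin.zero_le _) (Pi.single 0 1) (by simp [stage_zero])
    have h2 : pair (reducedRow m j 0) (Pi.single 0 1) = reducedRow m j 0 0 := by
      simp [pair, Pi.single_apply]
    rw [h2] at h1
    exact_mod_cast h1
  · exact le_max_left _ _

/-! ### Exponent vectors and normal forms -/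

/-- The covector `∑ u_v vec v` of the exponent vector `u` of a monomial. -/
noncomputable def weight (m : Fin n → Fin (n + 1) → ℤ) : (Var n →₀ ℕ) →ₗ[ℕ] (Fin (n + 1) → ℤ) :=
  Finsupp.linearCombination ℕ (vec m)

@[simp] lemma weight_single (m : Fin n → Fin (n + 1) → ℤ) (v : Var n) :
    weight m (Finsupp.single v 1) = vec m v := by
  simp [weight]

lemma weight_apply (m : Fin n → Fin (n + 1) → ℤ) (u : Var n →₀ ℕ) (c : Fin (n + 1)) :
    weight m u c = u (Sum.inl c) +
      ∑ l : Fin n, (u (Sum.inr l) : ℤ) * (m l c - (Pi.single l.succ 1 : Fin (n + 1) → ℤ) c) := by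
  rw [weight, Finsupp.linearCombination_apply, Finsupp.sum_fintype _ _ (by simp)]
  simp [Fintype.sum_sum_type, vec, Finset.sum_apply, Pi.single_apply]

/-- The exponent vector of the first monomial of `f_j`. -/
noncomputable def headExp (m : Fin n → Fin (n + 1) → ℤ) (j : Fin n) : Var n →₀ ℕ :=
  ∑ c ∈ Finset.Iic j.castSucc, Finsupp.single (Sum.inl c) (mu m j c).toNat +
    ∑ r ∈ Finset.Iio j, Finsupp.single (Sum.inr r) (-lam m j r.succ).toNat

/-- The exponent vector of `z_{j+1} z_{d+j}`, the second monomial of `f_j`. -/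
noncomputable def tailExp (j : Fin n) : Var n →₀ ℕ :=
  Finsupp.single (Sum.inl j.succ) 1 + Finsupp.single (Sum.inr j) 1

lemma binomial_eq (m : Fin n → Fin (n + 1) → ℤ) (j : Fin n) :
    binomial m j = MvPolynomial.monomial (headExp m j) 1 -
      MvPolynomial.monomial (tailExp j) 1 := by
  simp only [binomial, headExp, tailExp, MvPolynomial.X_pow_eq_monomial]
  simp only [MvPolynomial.X, ← MvPolynomial.monomial_sum_one, MvPolynomial.monomial_mul, one_mul]

lemma headExp_inl (m : Fin n → Fin (n + 1) → ℤ) (j : Fin n) (c : Fin (n + 1)) :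
    headExp m j (Sum.inl c) = if c ≤ j.castSucc then (mu m j c).toNat else 0 := by
  simp [headExp, Finsupp.single_apply]

lemma headExp_inr (m : Fin n → Fin (n + 1) → ℤ) (j l : Fin n) :
    headExp m j (Sum.inr l) = if l < j then (-lam m j l.succ).toNat else 0 := by
  simp [headExp, Finsupp.single_apply]

lemma reducedRow_apply_of_lt (hm : IsAdmissible m) {j : Fin n} {c : Fin (n + 1)}
    (h : j.castSucc < c) : reducedRow m j c c = 0 := by
  have he : (Finset.univ.filter fun r : Fin n => c ≤ r.castSucc ∧ r < j) = ∅ :=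
    Finset.filter_eq_empty_iff.2 fun r _ hr =>
      (h.trans_le hr.1).not_gt (Fin.castSucc_lt_castSucc_iff.2 hr.2)
  rw [reducedRow, he, Finset.sum_empty, add_zero, row_apply_eq_zero hm h]

lemma lam_of_lt (hm : IsAdmissible m) {j : Fin n} {c : Fin (n + 1)} (h : j.castSucc < c) :
    lam m j c = 0 := by
  simp [lam_eq, reducedRow_apply_of_lt hm h]

lemma mu_of_lt (hm : IsAdmissible m) {j : Fin n} {c : Fin (n + 1)} (h : j.castSucc < c) :
    mu m j c = 0 := by
  simp [mu_eq, reducedRow_apply_of_lt hm h]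

lemma coe_headExp_inl (hm : IsAdmissible m) (j : Fin n) (c : Fin (n + 1)) :
    (headExp m j (Sum.inl c) : ℤ) = mu m j c := by
  rw [headExp_inl]
  split_ifs with h
  · exact Int.toNat_of_nonneg (mu_nonneg hm j c)
  · rw [mu_of_lt hm (not_le.1 h)]
    rfl

lemma coe_headExp_inr (hm : IsAdmissible m) (j l : Fin n) :
    (headExp m j (Sum.inr l) : ℤ) = -lam m j l.succ := by
  rw [headExp_inr]
  split_ifs with h
  · exact Int.toNat_of_nonneg (neg_nonneg.2 (lam_nonpos m j _))
  · rw [lam_of_lt hm (Fin.castSucc_lt_succ_iff.2 (not_lt.1 h))]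
    rfl

lemma weight_tailExp (m : Fin n → Fin (n + 1) → ℤ) (j : Fin n) :
    weight m (tailExp j) = m j := by
  simp [tailExp, vec]

lemma weight_headExp (hm : IsAdmissible m) (j : Fin n) : weight m (headExp m j) = m j := by
  ext c
  rw [weight_apply, coe_headExp_inl hm]
  simp only [coe_headExp_inr hm, mul_sub, Finset.sum_sub_distrib]
  have h1 : ∑ l : Fin n, -lam m j l.succ * (Pi.single l.succ 1 : Fin (n + 1) → ℤ) c =
      -lam m j c := by
    rcases Fin.eq_zero_or_eq_succ c with rfl | ⟨c, rfl⟩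
    · simp [lam_eq]
    · simp [Pi.single_apply]
  have h2 : ∑ l : Fin n, -lam m j l.succ * m l c =
      -∑ r ∈ Finset.Iio j, lam m j r.succ * m r c := by
    rw [← Finset.sum_neg_distrib]
    symm
    refine (Finset.sum_congr rfl fun l _ => (neg_mul _ _).symm).trans
      (Finset.sum_subset (Finset.subset_univ _) fun l _ hl => ?_)
    rw [lam_of_lt hm (Fin.castSucc_lt_succ_iff.2 (by simpa using hl)), neg_zero, zero_mul]
  have h3 := mu_add_lam hm j c
  rw [h1, h2]
  linarith

/-- Normal forms are the exponent vectors of the monomials that no `z_{l+1} z_{d+l}` divides. -/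
def IsNormal (u : Var n →₀ ℕ) : Prop := ∀ l : Fin n, u (Sum.inl l.succ) = 0 ∨ u (Sum.inr l) = 0

lemma isNormal_headExp (hm : IsAdmissible m) (j : Fin n) : IsNormal (headExp m j) := by
  intro l
  rcases mu_succ_eq_zero_or m j l with h | h
  · left
    have := coe_headExp_inl hm j l.succ
    omega
  · right
    have := coe_headExp_inr hm j l
    omega

lemma isNormal_single (v : Var n) : IsNormal (Finsupp.single v 1) := by
  intro l
  rcases v with k | k
  · right; simp
  · left; simp

/-- A normal form is determined by its covector: by descending induction, coordinate `l + 1` of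
the covector determines `u(z_{l+1}) - u(z_{d+l})`, and one of these two numbers is zero. -/
lemma IsNormal.ext (hm : IsAdmissible m) {u u' : Var n →₀ ℕ} (hu : IsNormal u)
    (hu' : IsNormal u') (h : weight m u = weight m u') : u = u' := by
  have hcoord : ∀ c, (u (Sum.inl c) : ℤ) + ∑ l : Fin n, (u (Sum.inr l) : ℤ) *
      (m l c - (Pi.single l.succ 1 : Fin (n + 1) → ℤ) c) = u' (Sum.inl c) +
      ∑ l : Fin n, (u' (Sum.inr l) : ℤ) * (m l c - (Pi.single l.succ 1 : Fin (n + 1) → ℤ) c) := by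
    intro c
    rw [← weight_apply, ← weight_apply, h]
  have key : ∀ l : Fin n, u (Sum.inl l.succ) = u' (Sum.inl l.succ) ∧
      u (Sum.inr l) = u' (Sum.inr l) := by
    intro l
    induction l using WellFoundedGT.induction with
    | ind l ih =>
      have h1 := hcoord l.succ
      have h2 : ∑ k : Fin n, (u (Sum.inr k) : ℤ) * (m k l.succ -
          (Pi.single k.succ 1 : Fin (n + 1) → ℤ) l.succ) + u (Sum.inr l) =
          ∑ k : Fin n, (u' (Sum.inr k) : ℤ) * (m k l.succ -
          (Pi.single k.succ 1 : Fin (n + 1) → ℤ) l.succ) + u' (Sum.inr l) := by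
        rw [← Finset.sum_erase_add _ _ (Finset.mem_univ l),
          ← Finset.sum_erase_add _ _ (Finset.mem_univ l)]
        simp only [row_apply_eq_zero hm l.castSucc_lt_succ, Pi.single_eq_same]
        have : ∑ k ∈ Finset.univ.erase l, (u (Sum.inr k) : ℤ) * (m k l.succ -
            (Pi.single k.succ 1 : Fin (n + 1) → ℤ) l.succ) =
            ∑ k ∈ Finset.univ.erase l, (u' (Sum.inr k) : ℤ) * (m k l.succ -
            (Pi.single k.succ 1 : Fin (n + 1) → ℤ) l.succ) := by
          refine Finset.sum_congr rfl fun k hk => ?_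
          rcases lt_or_gt_of_ne (Finset.ne_of_mem_erase hk) with hlt | hgt
          · have h3 : (Pi.single k.succ 1 : Fin (n + 1) → ℤ) l.succ = 0 :=
              Pi.single_eq_of_ne (Fin.succ_injective _ |>.ne hlt.ne') _
            rw [h3, row_apply_eq_zero hm (Fin.castSucc_lt_succ_iff.2 hlt.le)]
            simp
          · rw [(ih k hgt).2]
        rw [this]
        ring
      have h3 := hu l
      have h4 := hu' l
      omega
  ext v
  rcases v with c | l
  · rcases Fin.eq_zero_or_eq_succ c with rfl | ⟨c, rfl⟩
    · have h1 := hcoord 0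
      simp only [fun l => (key l).2] at h1
      omega
    · exact (key c).1
  · exact (key l).2

/-- The index of the polytope at which a variable appears. -/
def level : Var n → ℕ
  | Sum.inl c => c
  | Sum.inr r => r + 1

/-- A grading in which the first monomial of every `f_j` has smaller degree than the second:
variables get the weight `(B + 1) ^ level`, where `B` bounds the total degrees. -/
lemma exists_degree_lt (m : Fin n → Fin (n + 1) → ℤ) :
    ∃ D : (Var n →₀ ℕ) →ₗ[ℕ] ℕ, ∀ j, D (headExp m j) < D (tailExp j) := by
  obtain ⟨B, hB⟩ : ∃ B : ℕ, ∀ j, (headExp m j).degree ≤ B :=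
    ⟨∑ j, (headExp m j).degree, fun j =>
      Finset.single_le_sum (f := fun j => (headExp m j).degree) (fun _ _ => Nat.zero_le _)
        (Finset.mem_univ j)⟩
  refine ⟨Finsupp.linearCombination ℕ fun v => (B + 1) ^ level v, fun j => ?_⟩
  have h1 : Finsupp.linearCombination ℕ (fun v => (B + 1) ^ level v) (headExp m j) ≤
      (headExp m j).degree * (B + 1) ^ (j : ℕ) := by
    rw [Finsupp.linearCombination_apply, Finsupp.sum, Finsupp.degree_apply,
      Finset.sum_mul]
    refine Finset.sum_le_sum fun v hv => ?_
    refine Nat.mul_le_mul_left _ (Nat.pow_le_pow_right (Nat.succ_pos B) ?_)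
    have hv' := Finsupp.mem_support_iff.1 hv
    rcases v with c | l
    · rw [headExp_inl] at hv'
      have : c ≤ j.castSucc := by
        by_contra h
        simp [h] at hv'
      exact this
    · rw [headExp_inr] at hv'
      have : l < j := by
        by_contra h
        simp [h] at hv'
      exact Nat.succ_le_of_lt this
  have h2 : Finsupp.linearCombination ℕ (fun v => (B + 1) ^ level v) (tailExp j) =
      (B + 1) ^ ((j : ℕ) + 1) + (B + 1) ^ ((j : ℕ) + 1) := by
    rw [tailExp, map_add, Finsupp.linearCombination_single, Finsupp.linearCombination_single,
      one_smul, one_smul]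
    rfl
  have h3 : 0 < (B + 1) ^ (j : ℕ) := pow_pos (Nat.succ_pos B) _
  rw [h2, pow_succ]
  nlinarith [Nat.mul_le_mul_right ((B + 1) ^ (j : ℕ)) (hB j)]

/-- Replacing a factor `z_{j+1} z_{d+j}` by the first monomial of `f_j` as long as possible:
a property of exponent vectors that holds for normal forms and can be pulled back along these
replacements holds for all exponent vectors. -/
lemma reduction_induction (m : Fin n → Fin (n + 1) → ℤ) {p : (Var n →₀ ℕ) → Prop}
    (normal : ∀ u, IsNormal u → p u)
    (step : ∀ j w, p (headExp m j + w) → p (tailExp j + w)) (u : Var n →₀ ℕ) : p u := by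
  obtain ⟨D, hD⟩ := exists_degree_lt m
  induction hd : D u using Nat.strong_induction_on generalizing u with
  | _ d ih =>
    subst hd
    by_cases hu : IsNormal u
    · exact normal u hu
    · simp only [IsNormal, not_forall, not_or] at hu
      obtain ⟨j, h1, h2⟩ := hu
      have hle : tailExp j ≤ u := by
        intro v
        rcases v with c | l
        · by_cases hc : j.succ = c
          · subst hc
            simpa [tailExp] using Nat.one_le_iff_ne_zero.2 h1
          · simp [tailExp, hc]
        · by_cases hc : j = l
          · subst hc
            simpa [tailExp] using Nat.one_le_iff_ne_zero.2 h2
          · simp [tailExp, hc]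
      obtain ⟨w, rfl⟩ := exists_add_of_le hle
      refine step j w (ih _ ?_ _ rfl)
      rw [map_add, map_add]
      exact Nat.add_lt_add_right (hD j) _

/-- A product of at least two variables with the same covector as a single variable `v` forces
a row `m_j = vec v`: in the last replacement that leads to `z_v` the monomial
`z_{j+1} z_{d+j}` is turned into `z_v`. -/
lemma exists_row_eq_vec (hm : IsAdmissible m) {u : Var n →₀ ℕ} {v : Var n}
    (h : weight m u = vec m v) (hu : u ≠ Finsupp.single v 1) : ∃ j, m j = vec m v := by
  induction u using reduction_induction m with
  | normal u hn =>
    exact absurd (hn.ext hm (isNormal_single v) (by simpa using h)) hu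
  | step j w ih =>
    rw [map_add, weight_tailExp, ← weight_headExp hm j, ← map_add] at h
    by_cases heq : headExp m j + w = Finsupp.single v 1
    · have h0 : headExp m j ≠ 0 := by
        intro h0
        have := weight_headExp hm j
        rw [h0, map_zero] at this
        exact hm.ne_zero j this.symm
      have hw : w = 0 := by
        have hd : (headExp m j).degree + w.degree = 1 := by
          rw [← map_add, heq, Finsupp.degree_single]
        have : (headExp m j).degree ≠ 0 := fun h => h0 ((Finsupp.degree_eq_zero_iff _).1 h)
        exact (Finsupp.degree_eq_zero_iff _).1 (by omega)
      refine ⟨j, ?_⟩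
      rw [← weight_headExp hm j, ← add_zero (headExp m j), ← hw, heq, weight_single]
    · exact ih h heq

/-- The ideal generated by all the binomials. -/
noncomputable def binomialIdeal (m : Fin n → Fin (n + 1) → ℤ) : Ideal (MvPolynomial (Var n) ℂ) :=
  Ideal.span (Set.range (binomial m))

lemma binomial_mem (m : Fin n → Fin (n + 1) → ℤ) (j : Fin n) : binomial m j ∈ binomialIdeal m :=
  Ideal.subset_span (Set.mem_range_self j)

lemma exists_isNormal (hm : IsAdmissible m) (u : Var n →₀ ℕ) :
    ∃ u', IsNormal u' ∧ weight m u' = weight m u ∧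
      (MvPolynomial.monomial u 1 - MvPolynomial.monomial u' 1 : MvPolynomial (Var n) ℂ) ∈
        binomialIdeal m := by
  induction u using reduction_induction m with
  | normal u hn => exact ⟨u, hn, rfl, by simp⟩
  | step j w ih =>
    obtain ⟨u', h1, h2, h3⟩ := ih
    refine ⟨u', h1, ?_, ?_⟩
    · rw [h2, map_add, map_add, weight_tailExp, weight_headExp hm]
    · have h4 : (MvPolynomial.monomial (tailExp j + w) 1 - MvPolynomial.monomial u' 1 :
          MvPolynomial (Var n) ℂ) = MvPolynomial.monomial (headExp m j + w) 1 -
          MvPolynomial.monomial u' 1 - binomial m j * MvPolynomial.monomial w 1 := by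
        simp only [binomial_eq, sub_mul, MvPolynomial.monomial_mul, mul_one]
        ring
      rw [h4]
      exact sub_mem h3 (Ideal.mul_mem_right _ _ (binomial_mem m j))

/-- Monomials with the same covector are congruent modulo the binomials. -/
lemma monomial_sub_monomial_mem (hm : IsAdmissible m) {u u' : Var n →₀ ℕ}
    (h : weight m u = weight m u') :
    (MvPolynomial.monomial u 1 - MvPolynomial.monomial u' 1 : MvPolynomial (Var n) ℂ) ∈
      binomialIdeal m := by
  obtain ⟨w, h1, h2, h3⟩ := exists_isNormal hm u
  obtain ⟨w', h1', h2', h3'⟩ := exists_isNormal hm u'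
  have hw : w = w' := h1.ext hm h1' (by rw [h2, h2', h])
  subst hw
  simpa using sub_mem h3 h3'

/-! ### The presentation by all the variables -/

lemma character_zero {d : ℕ} (σ : Set (Fin d → ℝ)) : character σ 0 = 1 := rfl

lemma character_add {d : ℕ} (σ : Set (Fin d → ℝ)) (a b : dualMonoid σ) :
    character σ (a + b) = character σ a * character σ b := by
  simp [character, AddMonoidAlgebra.single_mul_single]

lemma character_injective {d : ℕ} (σ : Set (Fin d → ℝ)) : Function.Injective (character σ) :=
  AddMonoidAlgebra.single_left_injective one_ne_zero

lemma weight_mem (hm : IsAdmissible m) (u : Var n →₀ ℕ) :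
    weight m u ∈ dualMonoid (nakajimaCone m) := by
  rw [weight, Finsupp.linearCombination_apply]
  exact sum_mem fun v _ => nsmul_mem (vec_mem hm v) _

lemma exists_weight_eq (hm : IsAdmissible m) {a : Fin (n + 1) → ℤ}
    (ha : a ∈ dualMonoid (nakajimaCone m)) : ∃ u, weight m u = a := by
  have h : AddSubmonoid.closure (Set.range (vec m)) ≤ AddMonoidHom.mrange (weight m) := by
    refine AddSubmonoid.closure_le.2 ?_
    rintro _ ⟨v, rfl⟩
    exact ⟨Finsupp.single v 1, weight_single m v⟩
  exact h (mem_closure_range_vec hm ha)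

/-- The character of the covector of a monomial, as a homomorphism on exponent vectors. -/
noncomputable def dualWeight (hm : IsAdmissible m) :
    (Var n →₀ ℕ) →+ dualMonoid (nakajimaCone m) :=
  (weight m).toAddMonoidHom.codRestrict _ (weight_mem hm)

/-- The homomorphism from the polynomial ring in all `2d - 1` variables to `ℂ[S]`. -/
noncomputable def evalVec (hm : IsAdmissible m) :
    MvPolynomial (Var n) ℂ →ₐ[ℂ] toricRing (nakajimaCone m) :=
  MvPolynomial.aeval fun v => character _ ⟨vec m v, vec_mem hm v⟩

lemma evalVec_X (hm : IsAdmissible m) (v : Var n) :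
    evalVec hm (MvPolynomial.X v) = character _ ⟨vec m v, vec_mem hm v⟩ :=
  MvPolynomial.aeval_X _ _

lemma evalVec_monomial (hm : IsAdmissible m) (u : Var n →₀ ℕ) :
    evalVec hm (MvPolynomial.monomial u 1) = character _ (dualWeight hm u) := by
  induction u using Finsupp.induction_linear with
  | zero => simp [character_zero]
  | add u v hu hv =>
    rw [map_add, character_add, ← hu, ← hv, ← map_mul, MvPolynomial.monomial_mul, one_mul]
  | single v k =>
    rw [← MvPolynomial.X_pow_eq_monomial, map_pow, evalVec_X]
    have : Finsupp.single v k = k • Finsupp.single v 1 := by simp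
    rw [this, map_nsmul]
    have h1 : dualWeight hm (Finsupp.single v 1) = ⟨vec m v, vec_mem hm v⟩ :=
      Subtype.ext (weight_single m v)
    rw [h1]
    induction k with
    | zero => simp [character_zero]
    | succ k ih => rw [pow_succ, ih (by simp), succ_nsmul, character_add]

lemma evalVec_surjective (hm : IsAdmissible m) : Function.Surjective (evalVec hm) := by
  intro f
  induction f using AddMonoidAlgebra.induction_linear with
  | zero => exact ⟨0, map_zero _⟩
  | add f g hf hg =>
    obtain ⟨p, rfl⟩ := hf
    obtain ⟨q, rfl⟩ := hg
    exact ⟨p + q, map_add _ _ _⟩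
  | single a r =>
    obtain ⟨u, hu⟩ := exists_weight_eq hm a.2
    refine ⟨r • MvPolynomial.monomial u 1, ?_⟩
    have h : dualWeight hm u = a := Subtype.ext hu
    rw [map_smul, evalVec_monomial, h, character, AddMonoidAlgebra.smul_single, smul_eq_mul,
      mul_one]

/-- The binomials `f_j` generate the relations between the characters `e(vec v)`: an inverse of
the induced homomorphism sends `e(a)` to the class of any monomial with covector `a`. -/
lemma ker_evalVec (hm : IsAdmissible m) : RingHom.ker (evalVec hm) = binomialIdeal m := by
  refine le_antisymm ?_ ?_
  · choose u hu using fun a : dualMonoid (nakajimaCone m) => exists_weight_eq hm a.2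
    have hcongr : ∀ {w w'}, weight m w = weight m w' →
        Ideal.Quotient.mk (binomialIdeal m) (MvPolynomial.monomial w 1) =
          Ideal.Quotient.mk (binomialIdeal m) (MvPolynomial.monomial w' 1) := fun h =>
      Ideal.Quotient.eq.2 (monomial_sub_monomial_mem hm h)
    let F : Multiplicative (dualMonoid (nakajimaCone m)) →*
        MvPolynomial (Var n) ℂ ⧸ binomialIdeal m :=
      { toFun := fun a => Ideal.Quotient.mk _ (MvPolynomial.monomial (u a.toAdd) 1)
        map_one' := by
          rw [hcongr (w' := 0)]
          · rfl
          · rw [hu]; simp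
        map_mul' := fun a b => by
          rw [← map_mul, MvPolynomial.monomial_mul, one_mul]
          refine hcongr ?_
          rw [map_add, hu, hu, hu]
          rfl }
    let s := AddMonoidAlgebra.lift ℂ (MvPolynomial (Var n) ℂ ⧸ binomialIdeal m) _ F
    have hs : s.comp (evalVec hm) = Ideal.Quotient.mkₐ ℂ (binomialIdeal m) := by
      refine MvPolynomial.algHom_ext fun v => ?_
      rw [AlgHom.comp_apply, evalVec_X, character, AddMonoidAlgebra.lift_single, one_smul]
      refine hcongr ?_
      rw [hu]
      exact (weight_single m v).symm
    intro p hp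
    have h1 := congrArg (fun f => f p) hs
    simp only [AlgHom.comp_apply, (RingHom.mem_ker).1 hp, map_zero] at h1
    exact Ideal.Quotient.eq_zero_iff_mem.1 h1.symm
  · refine Ideal.span_le.2 ?_
    rintro _ ⟨j, rfl⟩
    rw [SetLike.mem_coe, RingHom.mem_ker, binomial_eq, map_sub, evalVec_monomial,
      evalVec_monomial, sub_eq_zero]
    congr 1
    exact Subtype.ext ((weight_headExp hm j).trans (weight_tailExp m j).symm)

/-! ### The Hilbert basis -/

lemma vec_inr_apply (hm : IsAdmissible m) (l : Fin n) : vec m (Sum.inr l) l.succ = -1 := by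
  simp [vec, row_apply_eq_zero hm l.castSucc_lt_succ]

lemma vec_inr_apply_of_lt (hm : IsAdmissible m) {l : Fin n} {i : Fin (n + 1)} (h : l.succ < i) :
    vec m (Sum.inr l) i = 0 := by
  simp [vec, row_apply_eq_zero hm (l.castSucc_lt_succ.trans h), h.ne']

lemma vec_ne_zero (hm : IsAdmissible m) (v : Var n) : vec m v ≠ 0 := by
  intro h
  rcases v with k | l
  · simpa [vec] using congrFun h k
  · simpa [vec_inr_apply hm] using congrFun h l.succ

lemma vec_injective (hm : IsAdmissible m) : Function.Injective (vec m) := by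
  have hne : ∀ k l, vec m (Sum.inl k) ≠ vec m (Sum.inr l) := by
    intro k l h
    have h1 := congrFun h l.succ
    rw [vec_inr_apply hm] at h1
    by_cases hk : l.succ = k
    · subst hk
      simp [vec] at h1
    · simp [vec, hk] at h1
  have hlt : ∀ l l', l < l' → vec m (Sum.inr l) ≠ vec m (Sum.inr l') := by
    intro l l' hl h
    have h1 := congrFun h l'.succ
    rw [vec_inr_apply hm, vec_inr_apply_of_lt hm (Fin.succ_lt_succ_iff.2 hl)] at h1
    simp at h1
  rintro (k | l) (k' | l') h
  · by_cases hk : k = k'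
    · rw [hk]
    · have h1 := congrFun h k
      simp [vec, hk] at h1
  · exact absurd h (hne k l')
  · exact absurd h.symm (hne k' l)
  · rcases lt_trichotomy l l' with h1 | rfl | h1
    · exact absurd h (hlt _ _ h1)
    · rfl
    · exact absurd h.symm (hlt _ _ h1)

/-- The variables whose covector is one of the rows `m_j`, that is, the `z_k` with `k ∈ 𝔔` and
the `z_{d+l}` with `l ∈ ℜ`. -/
def elimSet (m : Fin n → Fin (n + 1) → ℤ) : Set (Var n) := {v | ∃ j, m j = vec m v}

lemma le_of_row_eq_inl (hm : IsAdmissible m) {j : Fin n} {k : Fin (n + 1)}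
    (h : m j = vec m (Sum.inl k)) : k ≤ j.castSucc := by
  by_contra hlt
  have h1 := congrFun h k
  rw [row_apply_eq_zero hm (not_le.1 hlt)] at h1
  simp [vec] at h1

lemma lt_of_row_eq_inr (hm : IsAdmissible m) {j l : Fin n}
    (h : m j = vec m (Sum.inr l)) : l < j := by
  by_contra hlt
  have h1 := congrFun h l.succ
  rw [row_apply_eq_zero hm (Fin.castSucc_lt_succ_iff.2 (not_lt.1 hlt)), vec_inr_apply hm] at h1
  simp at h1

lemma mem_setQ_iff (hm : IsAdmissible m) {k : Fin (n + 1)} :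
    k ∈ setQ m ↔ Sum.inl k ∈ elimSet m :=
  ⟨fun ⟨g, _, h⟩ => ⟨g, h.symm⟩, fun ⟨g, h⟩ => ⟨g, le_of_row_eq_inl hm h, h.symm⟩⟩

lemma mem_setR_iff (hm : IsAdmissible m) {l : Fin n} :
    l ∈ setR m ↔ Sum.inr l ∈ elimSet m :=
  ⟨fun ⟨g, _, h⟩ => ⟨g, h.symm⟩, fun ⟨g, h⟩ => ⟨g, lt_of_row_eq_inr hm h, h.symm⟩⟩

lemma toVar_injective : Function.Injective (RemVar.toVar (m := m)) :=
  Sum.map_injective.2 ⟨Subtype.val_injective, Subtype.val_injective⟩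

lemma range_toVar (hm : IsAdmissible m) :
    Set.range (RemVar.toVar (m := m)) = (elimSet m)ᶜ := by
  ext v
  rw [Set.mem_compl_iff]
  constructor
  · rintro ⟨⟨k, hk⟩ | ⟨l, hl⟩, rfl⟩
    · exact fun h => hk ((mem_setQ_iff hm).2 h)
    · exact fun h => hl ((mem_setR_iff hm).2 h)
  · intro h
    rcases v with k | l
    · exact ⟨Sum.inl ⟨k, fun hk => h ((mem_setQ_iff hm).1 hk)⟩, rfl⟩
    · exact ⟨Sum.inr ⟨l, fun hl => h ((mem_setR_iff hm).1 hl)⟩, rfl⟩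

lemma vec_mem_hilbertBasis (hm : IsAdmissible m) {v : Var n} (hv : v ∉ elimSet m) :
    vec m v ∈ hilbertBasis (dualMonoid (nakajimaCone m)) := by
  refine ⟨vec_mem hm v, vec_ne_zero hm v, ?_⟩
  rintro ⟨b, hb, c, hc, hb0, hc0, h⟩
  obtain ⟨u, rfl⟩ := exists_weight_eq hm hb
  obtain ⟨w, rfl⟩ := exists_weight_eq hm hc
  refine hv (exists_row_eq_vec hm (u := u + w) (by rw [map_add, h]) fun heq => ?_)
  have hd : u.degree + w.degree = 1 := by rw [← map_add, heq, Finsupp.degree_single]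
  have hu : u.degree ≠ 0 := fun h0 => hb0 (by rw [(Finsupp.degree_eq_zero_iff _).1 h0, map_zero])
  have hw : w.degree ≠ 0 := fun h0 => hc0 (by rw [(Finsupp.degree_eq_zero_iff _).1 h0, map_zero])
  omega

lemma exists_vec_eq_of_mem_hilbertBasis (hm : IsAdmissible m) {a : Fin (n + 1) → ℤ}
    (ha : a ∈ hilbertBasis (dualMonoid (nakajimaCone m))) : ∃ v, v ∉ elimSet m ∧ vec m v = a := by
  obtain ⟨hmem, hne, hirr⟩ := ha
  obtain ⟨u, rfl⟩ := exists_weight_eq hm hmem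
  have hu : u ≠ 0 := by
    rintro rfl
    exact hne (map_zero _)
  obtain ⟨v, hv⟩ := Finsupp.support_nonempty_iff.2 hu
  have hle : Finsupp.single v 1 ≤ u := by
    rw [Finsupp.single_le_iff]
    exact Nat.one_le_iff_ne_zero.2 (Finsupp.mem_support_iff.1 hv)
  obtain ⟨w, rfl⟩ := exists_add_of_le hle
  have hw : weight m w = 0 := by
    by_contra hw
    exact hirr ⟨vec m v, vec_mem hm v, weight m w, weight_mem hm w, vec_ne_zero hm v, hw,
      by rw [map_add, weight_single]⟩
  have hvec : weight m (Finsupp.single v 1 + w) = vec m v := by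
    rw [map_add, hw, weight_single, add_zero]
  rw [hvec] at hirr ⊢
  refine ⟨v, ?_, rfl⟩
  rintro ⟨j, hj⟩
  exact hirr ⟨_, vec_mem hm (Sum.inl j.succ), _, vec_mem hm (Sum.inr j), vec_ne_zero hm _,
    vec_ne_zero hm _, by rw [← hj]; simp [vec]⟩

lemma bijOn_vec (hm : IsAdmissible m) :
    Set.BijOn (vec m) (Set.range (RemVar.toVar (m := m)))
      (hilbertBasis (dualMonoid (nakajimaCone m))) := by
  rw [range_toVar hm]
  exact ⟨fun v hv => vec_mem_hilbertBasis hm hv, (vec_injective hm).injOn,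
    fun a ha => exists_vec_eq_of_mem_hilbertBasis hm ha⟩

lemma hilbertBasis_eq (hm : IsAdmissible m) :
    hilbertBasis (dualMonoid (nakajimaCone m)) = vec m '' (elimSet m)ᶜ := by
  rw [← range_toVar hm, (bijOn_vec hm).image_eq]

lemma finite_hilbertBasis (hm : IsAdmissible m) :
    (hilbertBasis (dualMonoid (nakajimaCone m))).Finite := by
  rw [hilbertBasis_eq hm]
  exact (Set.toFinite _).image _

lemma ncard_hilbertBasis (hm : IsAdmissible m) :
    (hilbertBasis (dualMonoid (nakajimaCone m))).ncard = (elimSet m)ᶜ.ncard := by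
  rw [hilbertBasis_eq hm, Set.ncard_image_of_injective _ (vec_injective hm)]

/-! ### Elimination of variables -/

variable {γ : Fin (n + 1) → Fin n} {δ : Fin n → Fin n}

/-- The rows used for the substitutions. -/
def usedRows (m : Fin n → Fin (n + 1) → ℤ) (γ : Fin (n + 1) → Fin n) (δ : Fin n → Fin n) :
    Set (Fin n) := Sum.elim γ δ '' elimSet m

lemma notMem_usedRows_iff (hm : IsAdmissible m) (j : Fin n) :
    j ∉ usedRows m γ δ ↔ j ∉ γ '' setQ m ∧ j ∉ δ '' setR m := by
  rw [← not_or, not_iff_not]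
  constructor
  · rintro ⟨k | l, hv, rfl⟩
    · exact Or.inl ⟨k, (mem_setQ_iff hm).2 hv, rfl⟩
    · exact Or.inr ⟨l, (mem_setR_iff hm).2 hv, rfl⟩
  · rintro (⟨k, hk, rfl⟩ | ⟨l, hl, rfl⟩)
    · exact ⟨Sum.inl k, (mem_setQ_iff hm).1 hk, rfl⟩
    · exact ⟨Sum.inr l, (mem_setR_iff hm).1 hl, rfl⟩

lemma IsIndexChoice.row_eq (hc : IsIndexChoice m γ δ) (hm : IsAdmissible m) {v : Var n}
    (hv : v ∈ elimSet m) : m (Sum.elim γ δ v) = vec m v := by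
  rcases v with k | l
  · exact (hc.gamma_spec k ((mem_setQ_iff hm).2 hv)).2.symm
  · exact (hc.delta_spec l ((mem_setR_iff hm).2 hv)).2.symm

lemma elimVar_toVar (hc : IsIndexChoice m γ δ) (w : RemVar m) :
    elimVar hc w.toVar = MvPolynomial.X w := by
  rcases w with ⟨k, hk⟩ | ⟨l, hl⟩
  · simp [RemVar.toVar, elimVar, hk]
  · simp [RemVar.toVar, elimVar, hl]

lemma elimVar_of_mem (hc : IsIndexChoice m γ δ) (hm : IsAdmissible m) {v : Var n}
    (hv : v ∈ elimSet m) : elimVar hc v = elimVar hc (Sum.inl (Sum.elim γ δ v).succ) *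
      elimVar hc (Sum.inr (Sum.elim γ δ v)) := by
  rcases v with k | l
  · conv_lhs => rw [elimVar, dif_pos ((mem_setQ_iff hm).2 hv)]
    rfl
  · conv_lhs => rw [elimVar, dif_pos ((mem_setR_iff hm).2 hv)]
    rfl

/-- Induction along the substitutions: a variable is replaced by two variables of larger level. -/
lemma elim_induction (hc : IsIndexChoice m γ δ) (hm : IsAdmissible m) {p : Var n → Prop}
    (rem : ∀ w : RemVar m, p w.toVar)
    (step : ∀ v ∈ elimSet m, p (Sum.inl (Sum.elim γ δ v).succ) →
      p (Sum.inr (Sum.elim γ δ v)) → p v) (v : Var n) : p v := by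
  induction hd : n - level v using Nat.strong_induction_on generalizing v with
  | _ d ih =>
    subst hd
    by_cases hv : v ∈ elimSet m
    · have hlt : level v < ((Sum.elim γ δ v : Fin n) : ℕ) + 1 := by
        have h := hc.row_eq hm hv
        rcases v with k | l
        · exact Nat.lt_succ_of_le (le_of_row_eq_inl hm h)
        · exact Nat.succ_lt_succ (lt_of_row_eq_inr hm h)
      have hlt' := (Sum.elim γ δ v).2
      refine step v hv (ih _ ?_ _ rfl) (ih _ ?_ _ rfl)
      · change n - ((Sum.elim γ δ v : Fin n).succ : ℕ) < n - level v
        rw [Fin.val_succ]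
        omega
      · change n - (((Sum.elim γ δ v : Fin n) : ℕ) + 1) < n - level v
        omega
    · rw [← Set.mem_compl_iff, ← range_toVar hm] at hv
      obtain ⟨w, rfl⟩ := hv
      exact rem w

/-- The row used for the elimination of `v` has the single variable `v` as first monomial. -/
lemma headExp_of_mem (hc : IsIndexChoice m γ δ) (hm : IsAdmissible m) {v : Var n}
    (hv : v ∈ elimSet m) : headExp m (Sum.elim γ δ v) = Finsupp.single v 1 :=
  (isNormal_headExp hm _).ext hm (isNormal_single v)
    (by rw [weight_headExp hm, weight_single, hc.row_eq hm hv])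

lemma binomial_of_mem (hc : IsIndexChoice m γ δ) (hm : IsAdmissible m) {v : Var n}
    (hv : v ∈ elimSet m) : binomial m (Sum.elim γ δ v) = MvPolynomial.X v -
      MvPolynomial.X (Sum.inl (Sum.elim γ δ v).succ) *
        MvPolynomial.X (Sum.inr (Sum.elim γ δ v)) := by
  rw [binomial_eq, headExp_of_mem hc hm hv, tailExp]
  simp [MvPolynomial.X, MvPolynomial.monomial_mul]

lemma elim_X (hc : IsIndexChoice m γ δ) (v : Var n) :
    elim hc (MvPolynomial.X v) = elimVar hc v := MvPolynomial.aeval_X _ _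

lemma elim_binomial_eq_zero (hc : IsIndexChoice m γ δ) (hm : IsAdmissible m) {j : Fin n}
    (hj : j ∈ usedRows m γ δ) : elim hc (binomial m j) = 0 := by
  obtain ⟨v, hv, rfl⟩ := hj
  rw [binomial_of_mem hc hm hv, map_sub, map_mul, elim_X, elim_X, elim_X,
    elimVar_of_mem hc hm hv, sub_self]

/-- The inclusion of the polynomial ring in the remaining variables. -/
noncomputable def inclusion (m : Fin n → Fin (n + 1) → ℤ) :
    MvPolynomial (RemVar m) ℂ →ₐ[ℂ] MvPolynomial (Var n) ℂ :=
  MvPolynomial.rename RemVar.toVar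

lemma elim_inclusion (hc : IsIndexChoice m γ δ) (p : MvPolynomial (RemVar m) ℂ) :
    elim hc (inclusion m p) = p := by
  have h : (elim hc).comp (inclusion m) = AlgHom.id ℂ _ := by
    refine MvPolynomial.algHom_ext fun w => ?_
    rw [AlgHom.comp_apply, inclusion, MvPolynomial.rename_X, elim_X, elimVar_toVar]
    rfl
  exact DFunLike.congr_fun h p

/-- The elimination does not change the class of a polynomial modulo the binomials. -/
lemma evalVec_inclusion_elim (hc : IsIndexChoice m γ δ) (hm : IsAdmissible m)
    (p : MvPolynomial (Var n) ℂ) : evalVec hm (inclusion m (elim hc p)) = evalVec hm p := by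
  have h : ((evalVec hm).comp (inclusion m)).comp (elim hc) = evalVec hm := by
    refine MvPolynomial.algHom_ext fun v => ?_
    rw [AlgHom.comp_apply, AlgHom.comp_apply, elim_X]
    induction v using elim_induction hc hm with
    | rem w => rw [elimVar_toVar, inclusion, MvPolynomial.rename_X]
    | step v hv h1 h2 =>
      have h3 : evalVec hm (binomial m (Sum.elim γ δ v)) = 0 := by
        rw [← RingHom.mem_ker, ker_evalVec hm]
        exact binomial_mem m _
      rw [binomial_of_mem hc hm hv, map_sub, map_mul, sub_eq_zero] at h3
      rw [elimVar_of_mem hc hm hv, map_mul, map_mul, h1, h2, h3]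
  exact DFunLike.congr_fun h p

/-- The homomorphism from the polynomial ring in the remaining variables to `ℂ[S]`. -/
noncomputable def evalRem (hm : IsAdmissible m) :
    MvPolynomial (RemVar m) ℂ →ₐ[ℂ] toricRing (nakajimaCone m) :=
  (evalVec hm).comp (inclusion m)

lemma evalRem_X (hm : IsAdmissible m) (w : RemVar m) :
    evalRem hm (MvPolynomial.X w) = character _ ⟨vec m w.toVar, vec_mem hm w.toVar⟩ := by
  rw [evalRem, AlgHom.comp_apply, inclusion, MvPolynomial.rename_X, evalVec_X]

lemma evalRem_surjective (hc : IsIndexChoice m γ δ) (hm : IsAdmissible m) :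
    Function.Surjective (evalRem hm) := fun f => by
  obtain ⟨p, rfl⟩ := evalVec_surjective hm f
  exact ⟨elim hc p, evalVec_inclusion_elim hc hm p⟩

lemma map_elim_binomialIdeal (hc : IsIndexChoice m γ δ) (hm : IsAdmissible m) :
    (binomialIdeal m).map (elim hc) = remainingIdeal hc := by
  rw [binomialIdeal, Ideal.map_span, remainingIdeal]
  refine le_antisymm (Ideal.span_le.2 ?_) (Ideal.span_mono ?_)
  · rintro _ ⟨_, ⟨j, rfl⟩, rfl⟩
    by_cases hj : j ∈ usedRows m γ δ
    · have h0 := elim_binomial_eq_zero hc hm hj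
      change elim hc (binomial m j) ∈ _
      rw [h0]
      exact zero_mem _
    · exact Ideal.subset_span ⟨j, (notMem_usedRows_iff hm j).1 hj, rfl⟩
  · rintro _ ⟨j, _, rfl⟩
    exact ⟨_, ⟨j, rfl⟩, rfl⟩

lemma ker_evalRem (hc : IsIndexChoice m γ δ) (hm : IsAdmissible m) :
    RingHom.ker (evalRem hm) = remainingIdeal hc := by
  rw [← map_elim_binomialIdeal hc hm]
  refine le_antisymm (fun p hp => ?_) (Ideal.map_le_iff_le_comap.2 fun p hp => ?_)
  · have h : inclusion m p ∈ binomialIdeal m := by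
      rw [← ker_evalVec hm]
      exact hp
    have h' := Ideal.mem_map_of_mem (elim hc) h
    rwa [elim_inclusion] at h'
  · rw [← ker_evalVec hm, RingHom.mem_ker] at hp
    rw [Ideal.mem_comap, RingHom.mem_ker, evalRem, AlgHom.comp_apply,
      evalVec_inclusion_elim hc hm, hp]

/-- The presentation of `ℂ[S]` by the remaining variables and binomials. -/
noncomputable def remainingEquiv (hc : IsIndexChoice m γ δ) (hm : IsAdmissible m) :
    (MvPolynomial (RemVar m) ℂ ⧸ remainingIdeal hc) ≃ₐ[ℂ] toricRing (nakajimaCone m) :=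
  (Ideal.quotientEquivAlgOfEq ℂ (ker_evalRem hc hm).symm).trans
    (Ideal.quotientKerAlgEquivOfSurjective (evalRem_surjective hc hm))

lemma remainingEquiv_mk (hc : IsIndexChoice m γ δ) (hm : IsAdmissible m)
    (p : MvPolynomial (RemVar m) ℂ) :
    remainingEquiv hc hm (Ideal.Quotient.mk _ p) = evalRem hm p := rfl

/-! ### Independence of the remaining binomials -/

/-- Exponent vectors as integral vectors. -/
def toInt (ι : Type*) : (ι →₀ ℕ) →+ (ι → ℤ) where
  toFun u v := u v
  map_zero' := by ext; simp
  map_add' u w := by ext; simp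

/-- The difference of the exponent vectors of the two monomials of `f_j`. -/
noncomputable def relation (m : Fin n → Fin (n + 1) → ℤ) (j : Fin n) : Var n → ℤ :=
  toInt _ (headExp m j) - toInt _ (tailExp j)

lemma linearIndependent_relation (m : Fin n → Fin (n + 1) → ℤ) :
    LinearIndependent ℤ (relation m) := by
  rw [Fintype.linearIndependent_iff]
  intro g hg j
  -- `z_{d+j}` occurs in `f_j` with exponent `1` and in no `f_k` with `k < j`
  induction j using WellFoundedGT.induction with
  | ind j ih =>
    have h := congrFun hg (Sum.inr j)
    rw [Finset.sum_apply, Finset.sum_eq_single j] at h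
    · simpa [relation, toInt, headExp_inr, tailExp] using h
    · intro k _ hk
      rcases lt_or_gt_of_ne hk with hlt | hgt
      · simp [relation, toInt, headExp_inr, tailExp, hlt.not_gt, hk]
      · simp [ih k hgt]
    · simp

/-- The elimination maps variables to monomials, and it changes exponent vectors only by
combinations of the relations used for the substitutions. -/
lemma exists_elimVar_eq_monomial (hc : IsIndexChoice m γ δ) (hm : IsAdmissible m) (v : Var n) :
    ∃ e : RemVar m →₀ ℕ, elimVar hc v = MvPolynomial.monomial e 1 ∧
      toInt _ (e.mapDomain RemVar.toVar) - toInt _ (Finsupp.single v 1) ∈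
        Submodule.span ℤ (relation m '' usedRows m γ δ) := by
  induction v using elim_induction hc hm with
  | rem w =>
    refine ⟨Finsupp.single w 1, elimVar_toVar hc w, ?_⟩
    simp [Finsupp.mapDomain_single]
  | step v hv h1 h2 =>
    obtain ⟨e1, h1, h1'⟩ := h1
    obtain ⟨e2, h2, h2'⟩ := h2
    refine ⟨e1 + e2, by rw [elimVar_of_mem hc hm hv, h1, h2, MvPolynomial.monomial_mul, one_mul],
      ?_⟩
    have h3 : relation m (Sum.elim γ δ v) ∈ Submodule.span ℤ (relation m '' usedRows m γ δ) :=
      Submodule.subset_span ⟨_, ⟨v, hv, rfl⟩, rfl⟩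
    have h4 := sub_mem (add_mem h1' h2') h3
    rw [relation, headExp_of_mem hc hm hv, tailExp, map_add] at h4
    rw [Finsupp.mapDomain_add, map_add]
    convert h4 using 1
    abel

/-- The elimination on exponent vectors. -/
lemma exists_elim_monomial (hc : IsIndexChoice m γ δ) (hm : IsAdmissible m) :
    ∃ E : (Var n →₀ ℕ) → (RemVar m →₀ ℕ), ∀ u,
      elim hc (MvPolynomial.monomial u 1) = MvPolynomial.monomial (E u) 1 ∧
      toInt _ ((E u).mapDomain RemVar.toVar) - toInt _ u ∈
        Submodule.span ℤ (relation m '' usedRows m γ δ) := by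
  suffices h : ∀ u, ∃ e : RemVar m →₀ ℕ,
      elim hc (MvPolynomial.monomial u 1) = MvPolynomial.monomial e 1 ∧
      toInt _ (e.mapDomain RemVar.toVar) - toInt _ u ∈
        Submodule.span ℤ (relation m '' usedRows m γ δ) by
    choose E hE using h
    exact ⟨E, hE⟩
  intro u
  induction u using Finsupp.induction_linear with
  | zero => exact ⟨0, by simp, by simp⟩
  | add u w hu hw =>
    obtain ⟨e1, h1, h1'⟩ := hu
    obtain ⟨e2, h2, h2'⟩ := hw
    refine ⟨e1 + e2, ?_, ?_⟩
    · have : (MvPolynomial.monomial (u + w) 1 : MvPolynomial (Var n) ℂ) =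
          MvPolynomial.monomial u 1 * MvPolynomial.monomial w 1 := by
        rw [MvPolynomial.monomial_mul, one_mul]
      rw [this, map_mul, h1, h2, MvPolynomial.monomial_mul, one_mul]
    · rw [Finsupp.mapDomain_add, map_add, map_add, add_sub_add_comm]
      exact add_mem h1' h2'
  | single v k =>
    obtain ⟨e, h1, h1'⟩ := exists_elimVar_eq_monomial hc hm v
    refine ⟨k • e, ?_, ?_⟩
    · rw [← MvPolynomial.X_pow_eq_monomial, map_pow, elim_X, h1, MvPolynomial.monomial_pow,
        one_pow]
    · have h2 : Finsupp.single v k = k • Finsupp.single v 1 := by simp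
      rw [h2, Finsupp.mapDomain_smul, map_nsmul, map_nsmul, ← smul_sub]
      exact nsmul_mem h1' k

/-- The exponent vectors `a`, `b` of the two monomials of a remaining binomial, together with
their relation to `f_j`. -/
lemma exists_remaining_exponents (hc : IsIndexChoice m γ δ) (hm : IsAdmissible m) :
    ∃ a b : Fin n → (RemVar m →₀ ℕ), (∀ j, elim hc (binomial m j) =
      MvPolynomial.monomial (a j) 1 - MvPolynomial.monomial (b j) 1) ∧
      ∀ j, toInt _ ((a j).mapDomain RemVar.toVar) - toInt _ ((b j).mapDomain RemVar.toVar) -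
        relation m j ∈ Submodule.span ℤ (relation m '' usedRows m γ δ) := by
  obtain ⟨E, hE⟩ := exists_elim_monomial hc hm
  refine ⟨fun j => E (headExp m j), fun j => E (tailExp j), fun j => ?_, fun j => ?_⟩
  · rw [binomial_eq, map_sub, (hE _).1, (hE _).1]
  · have h := sub_mem (hE (headExp m j)).2 (hE (tailExp j)).2
    rw [relation]
    convert h using 1
    abel

lemma monomial_sub_monomial_inj {ι : Type*} {a b a' b' : ι →₀ ℕ} (hab : a ≠ b)
    (h : (MvPolynomial.monomial a 1 - MvPolynomial.monomial b 1 : MvPolynomial ι ℂ) =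
      MvPolynomial.monomial a' 1 - MvPolynomial.monomial b' 1) : a = a' ∧ b = b' := by
  classical
  have hcoeff : ∀ c, ((if a = c then 1 else 0) - (if b = c then 1 else 0) : ℂ) =
      (if a' = c then 1 else 0) - (if b' = c then 1 else 0) := by
    intro c
    have := congrArg (MvPolynomial.coeff c) h
    simpa only [MvPolynomial.coeff_sub, MvPolynomial.coeff_monomial] using this
  have h1 := hcoeff a
  have h2 := hcoeff b
  rw [if_pos rfl, if_neg hab.symm] at h1
  rw [if_pos rfl, if_neg hab] at h2
  constructor
  · by_contra hne
    rw [if_neg (Ne.symm hne)] at h1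
    split_ifs at h1 <;> norm_num at h1
  · by_contra hne
    rw [if_neg (Ne.symm hne)] at h2
    split_ifs at h2 <;> norm_num at h2

lemma isBinomial_and_injOn (hc : IsIndexChoice m γ δ) (hm : IsAdmissible m) :
    (∀ j ∉ usedRows m γ δ, IsBinomial (elim hc (binomial m j))) ∧
      Set.InjOn (fun j => elim hc (binomial m j)) (usedRows m γ δ)ᶜ := by
  obtain ⟨a, b, hab, hrel⟩ := exists_remaining_exponents hc hm
  have hne : ∀ j ∉ usedRows m γ δ, a j ≠ b j := by
    intro j hj h
    have h1 := hrel j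
    rw [h, sub_self, zero_sub, neg_mem_iff] at h1
    exact (linearIndependent_relation m).notMem_span_image hj h1
  refine ⟨fun j hj => ⟨a j, b j, hne j hj, hab j⟩, fun j hj k hk h => ?_⟩
  by_contra hjk
  simp only [hab] at h
  obtain ⟨h1, h2⟩ := monomial_sub_monomial_inj (hne j hj) h
  have h3 := sub_mem (hrel k) (hrel j)
  rw [h1, h2, sub_sub_sub_cancel_left] at h3
  refine (linearIndependent_relation m).notMem_span_image (s := insert k (usedRows m γ δ)) (x := j)
    (by rintro (h | h); exacts [hjk h, hj h]) ?_
  have h4 := Submodule.span_mono (Set.image_mono (Set.subset_insert k _)) h3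
  have h5 : relation m k ∈ Submodule.span ℤ (relation m '' insert k (usedRows m γ δ)) :=
    Submodule.subset_span ⟨k, Set.mem_insert _ _, rfl⟩
  simpa using add_mem h4 h5

lemma remainingBinomials_eq (hc : IsIndexChoice m γ δ) (hm : IsAdmissible m) :
    remainingBinomials hc = (fun j => elim hc (binomial m j)) '' (usedRows m γ δ)ᶜ := by
  have h : {j : Fin n | j ∉ γ '' setQ m ∧ j ∉ δ '' setR m} = (usedRows m γ δ)ᶜ := by
    ext j
    exact (notMem_usedRows_iff hm j).symm
  rw [remainingBinomials, h]

lemma ncard_remainingBinomials (hc : IsIndexChoice m γ δ) (hm : IsAdmissible m) :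
    (remainingBinomials hc).ncard + (n + 1) =
      (hilbertBasis (dualMonoid (nakajimaCone m))).ncard := by
  have hinj : Set.InjOn (Sum.elim γ δ) (elimSet m) := fun v hv w hw h =>
    vec_injective hm (by rw [← hc.row_eq hm hv, ← hc.row_eq hm hw, h])
  have h1 := Set.ncard_add_ncard_compl (usedRows m γ δ)
  have h2 := Set.ncard_add_ncard_compl (elimSet m)
  have h3 : (usedRows m γ δ).ncard = (elimSet m).ncard := hinj.ncard_image
  rw [remainingBinomials_eq hc hm, (isBinomial_and_injOn hc hm).2.ncard_image,
    ncard_hilbertBasis hm]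
  simp only [Nat.card_eq_fintype_card, Fintype.card_sum, Fintype.card_fin] at h1 h2
  omega

/-! ### Lattice equivalent polytopes -/

section LatticeEquiv

variable {n d : ℕ}

lemma pair_ext {a b : Fin d → ℤ} (h : ∀ x, pair a x = pair b x) : a = b := by
  ext i
  have := h (Pi.single i 1)
  simpa [pair, Pi.single_apply] using this

/-- A linear map that preserves the lattice has a transpose on the dual lattice. -/
lemma exists_transpose (T : (Fin d → ℝ) →ₗ[ℝ] (Fin d → ℝ))
    (hT : ∀ x ∈ latticePoints d, T x ∈ latticePoints d) :
    ∃ F : (Fin d → ℤ) →+ (Fin d → ℤ), ∀ a x, pair (F a) x = pair a (T x) := by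
  have hsingle : ∀ i, (Pi.single i 1 : Fin d → ℝ) ∈ latticePoints d := fun i =>
    ⟨Pi.single i 1, by ext j; by_cases h : j = i <;> simp [h]⟩
  choose M hM using fun i => hT _ (hsingle i)
  refine ⟨AddMonoidHom.mk' (fun a i => ∑ j, a j * M i j) fun a b => ?_, fun a x => ?_⟩
  · ext i
    simp [add_mul, Finset.sum_add_distrib]
  · have hTx : T x = ∑ i, x i • T (Pi.single i 1) := by
      conv_lhs => rw [pi_eq_sum_univ' x, map_sum]
      simp only [map_smul]
    rw [hTx]
    simp only [← hM, pair, AddMonoidHom.mk'_apply, Finset.sum_apply, Pi.smul_apply, smul_eq_mul,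
      Int.cast_sum, Int.cast_mul, Finset.sum_mul, Finset.mul_sum]
    rw [Finset.sum_comm]
    exact Finset.sum_congr rfl fun j _ => Finset.sum_congr rfl fun i _ => by ring

/-- A lattice automorphism that maps `P` onto `Q` identifies the dual monoids of the cones. -/
lemma nonempty_dualMonoid_equiv {P Q : Set (Fin d → ℝ)} (L : (Fin d → ℝ) ≃ₗ[ℝ] (Fin d → ℝ))
    (hL : ∀ x ∈ latticePoints d, L x ∈ latticePoints d)
    (hL' : ∀ x ∈ latticePoints d, L.symm x ∈ latticePoints d) (hPQ : L '' P = Q) :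
    Nonempty (dualMonoid (coneOver P) ≃+ dualMonoid (coneOver Q)) := by
  obtain ⟨F, hF⟩ := exists_transpose L.toLinearMap hL
  obtain ⟨G, hG⟩ := exists_transpose L.symm.toLinearMap hL'
  have hFG : ∀ a, F (G a) = a := fun a => pair_ext fun x => by rw [hF, hG]; simp
  have hGF : ∀ a, G (F a) = a := fun a => pair_ext fun x => by rw [hG, hF]; simp
  have hGmem : ∀ a ∈ dualMonoid (coneOver P), G a ∈ dualMonoid (coneOver Q) := by
    intro a ha
    rw [mem_dualMonoid_coneOver] at ha ⊢
    rw [← hPQ]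
    rintro _ ⟨x, hx, rfl⟩
    rw [hG]
    simpa using ha x hx
  have hFmem : ∀ a ∈ dualMonoid (coneOver Q), F a ∈ dualMonoid (coneOver P) := by
    intro a ha
    rw [mem_dualMonoid_coneOver] at ha ⊢
    intro x hx
    rw [hF]
    exact ha _ (hPQ ▸ ⟨x, hx, rfl⟩)
  exact ⟨{
    toFun := fun a => ⟨G a.1, hGmem a.1 a.2⟩
    invFun := fun a => ⟨F a.1, hFmem a.1 a.2⟩
    left_inv := fun a => Subtype.ext (hFG a.1)
    right_inv := fun a => Subtype.ext (hGF a.1)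
    map_add' := fun a b => Subtype.ext (map_add G a.1 b.1) }⟩

/-- The hyperplane `x₁ = 1` as an affine subspace. -/
def hyperplaneOneAffine (n : ℕ) : AffineSubspace ℝ (Fin (n + 1) → ℝ) :=
  AffineSubspace.mk' (Pi.single 0 1) (LinearMap.ker (LinearMap.proj (R := ℝ) (φ := fun _ => ℝ) 0))

lemma mem_hyperplaneOneAffine {x : Fin (n + 1) → ℝ} : x ∈ hyperplaneOneAffine n ↔ x 0 = 1 := by
  simp [hyperplaneOneAffine, AffineSubspace.mem_mk', sub_eq_zero]

lemma affineSpan_le_hyperplaneOneAffine {P : Set (Fin (n + 1) → ℝ)} (hP : P ⊆ hyperplaneOne n) :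
    affineSpan ℝ P ≤ hyperplaneOneAffine n :=
  affineSpan_le.2 fun _ hx => mem_hyperplaneOneAffine.2 (hP hx)

lemma affineSpan_eq_of_span_eq_top {P : Set (Fin (n + 1) → ℝ)} (hP : P ⊆ hyperplaneOne n)
    (hspan : Submodule.span ℝ P = ⊤) : affineSpan ℝ P = hyperplaneOneAffine n := by
  refine le_antisymm (affineSpan_le_hyperplaneOneAffine hP) fun y hy => ?_
  rw [mem_hyperplaneOneAffine] at hy
  obtain ⟨q, hq⟩ : P.Nonempty := by
    by_contra h
    rw [Set.not_nonempty_iff_eq_empty.1 h, Submodule.span_empty] at hspan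
    exact bot_ne_top hspan
  have hle : Submodule.span ℝ P ≤ (affineSpan ℝ P).direction ⊔ Submodule.span ℝ {q} := by
    refine Submodule.span_le.2 fun x hx => ?_
    have h1 : x - q ∈ (affineSpan ℝ P).direction :=
      AffineSubspace.vsub_mem_direction (subset_affineSpan ℝ P hx) (subset_affineSpan ℝ P hq)
    have h2 := Submodule.add_mem_sup h1 (Submodule.mem_span_singleton_self q)
    simpa using h2
  have hy' : y ∈ (affineSpan ℝ P).direction ⊔ Submodule.span ℝ {q} := hle (hspan ▸ trivial)
  obtain ⟨v, hv, w, hw, rfl⟩ := Submodule.mem_sup.1 hy'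
  obtain ⟨c, rfl⟩ := Submodule.mem_span_singleton.1 hw
  have hv0 : v 0 = 0 := by
    have h1 := AffineSubspace.direction_le (affineSpan_le_hyperplaneOneAffine hP) hv
    rw [hyperplaneOneAffine, AffineSubspace.direction_mk'] at h1
    exact h1
  have hq0 : q 0 = 1 := hP hq
  have hc : c = 1 := by
    simpa [hv0, hq0] using hy
  rw [hc, one_smul]
  exact AffineSubspace.vadd_mem_of_mem_direction hv (subset_affineSpan ℝ P hq)

/-- `ℤ^d` as a subgroup of `ℝ^d`. -/
def latticeSubgroup (d : ℕ) : AddSubgroup (Fin d → ℝ) where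
  carrier := latticePoints d
  zero_mem' := ⟨0, by ext; simp⟩
  add_mem' := by
    rintro _ _ ⟨a, rfl⟩ ⟨b, rfl⟩
    exact ⟨a + b, by ext; simp⟩
  neg_mem' := by
    rintro _ ⟨a, rfl⟩
    exact ⟨-a, by ext; simp⟩

/-- The lattice is generated by its points in the hyperplane `x₁ = 1`. -/
lemma latticeSubgroup_le {A : AddSubgroup (Fin (n + 1) → ℝ)}
    (h : ∀ x ∈ latticePoints (n + 1), x 0 = 1 → x ∈ A) : latticeSubgroup (n + 1) ≤ A := by
  rintro _ ⟨a, rfl⟩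
  have h0 : (Pi.single 0 1 : Fin (n + 1) → ℝ) ∈ A :=
    h _ ⟨Pi.single 0 1, by ext j; by_cases hj : j = 0 <;> simp [hj]⟩ (by simp)
  -- replace the first coordinate by `1` and correct with a multiple of `e₁`
  have h1 : (fun i => ((Function.update a 0 1 : Fin (n + 1) → ℤ) i : ℝ)) ∈ A :=
    h _ ⟨_, rfl⟩ (by simp)
  have h2 := add_mem h1 (zsmul_mem h0 (a 0 - 1))
  convert h2 using 1
  ext j
  by_cases hj : j = 0
  · subst hj; simp
  · simp [hj]

lemma latticeOf_eq {P : Set (Fin (n + 1) → ℝ)} (hP : affineSpan ℝ P = hyperplaneOneAffine n) :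
    latticeOf P = latticeSubgroup (n + 1) := by
  rw [latticeOf, hP]
  refine le_antisymm ((AddSubgroup.closure_le _).2 fun x hx => hx.2) (latticeSubgroup_le ?_)
  exact fun x hx hx0 => AddSubgroup.subset_closure ⟨mem_hyperplaneOneAffine.2 hx0, hx⟩

/-- If `Q` spans the hyperplane `x₁ = 1`, so does every lattice equivalent polytope in it. -/
lemma affineSpan_eq_of_image_eq {P Q : Set (Fin (n + 1) → ℝ)} (hP : P ⊆ hyperplaneOne n)
    (hQ : affineSpan ℝ Q = hyperplaneOneAffine n) {w : (Fin (n + 1) → ℝ) →ᵃ[ℝ] (Fin (n + 1) → ℝ)}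
    (hw : w '' P = Q) : affineSpan ℝ P = hyperplaneOneAffine n := by
  have hle := affineSpan_le_hyperplaneOneAffine hP
  have hmap : (affineSpan ℝ P).map w = hyperplaneOneAffine n := by
    rw [AffineSubspace.map_span, hw, hQ]
  have hne : ((affineSpan ℝ P : AffineSubspace ℝ _) : Set (Fin (n + 1) → ℝ)).Nonempty := by
    have : ((hyperplaneOneAffine n : AffineSubspace ℝ _) : Set (Fin (n + 1) → ℝ)).Nonempty :=
      ⟨Pi.single 0 1, AffineSubspace.self_mem_mk' _ _⟩
    rw [← hmap, AffineSubspace.coe_map] at this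
    exact this.of_image
  refine AffineSubspace.eq_of_direction_eq_of_nonempty_of_le ?_ hne hle
  refine Submodule.eq_of_le_of_finrank_le (AffineSubspace.direction_le hle) ?_
  rw [← hmap, AffineSubspace.map_direction]
  exact Submodule.finrank_map_le _ _

/-- A lattice equivalence `w` extends from the hyperplane `x₁ = 1` to the linear automorphism
`x ↦ w x - w 0 + x₁ (w 0)` of the lattice. -/
theorem LatticeEquiv.nonempty_dualMonoid_equiv {P Q : Set (Fin (n + 1) → ℝ)}
    (h : LatticeEquiv P Q) (hP : P ⊆ hyperplaneOne n) (hQ : Q ⊆ hyperplaneOne n)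
    (hspan : Submodule.span ℝ Q = ⊤) :
    Nonempty (dualMonoid (coneOver P) ≃+ dualMonoid (coneOver Q)) := by
  obtain ⟨w, hbij, hPQ, hlat⟩ := h
  have hQ' := affineSpan_eq_of_span_eq_top hQ hspan
  have hP' := affineSpan_eq_of_image_eq hP hQ' hPQ
  rw [latticeOf_eq hP', latticeOf_eq hQ'] at hlat
  rw [hP', hQ'] at hbij
  have hw : ∀ x ∈ latticeSubgroup (n + 1), w x ∈ latticeSubgroup (n + 1) := fun x hx => by
    have : w x ∈ w '' (latticeSubgroup (n + 1) : Set (Fin (n + 1) → ℝ)) := ⟨x, hx, rfl⟩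
    rwa [hlat] at this
  have hw' : ∀ y ∈ latticeSubgroup (n + 1), ∃ x ∈ latticeSubgroup (n + 1), w x = y :=
    fun y hy => by
      have : y ∈ w '' (latticeSubgroup (n + 1) : Set (Fin (n + 1) → ℝ)) := by rwa [hlat]
      exact this
  have hlin : ∀ x, w x = w.linear x + w 0 := fun x => congrFun w.decomp x
  have hw0 : w 0 ∈ latticeSubgroup (n + 1) := hw 0 (zero_mem _)
  have hsingle : ∀ i, (Pi.single i 1 : Fin (n + 1) → ℝ) ∈ latticeSubgroup (n + 1) := fun i =>
    ⟨Pi.single i 1, by ext j; by_cases h : j = i <;> simp [h]⟩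
  have htop : ∀ A : Submodule ℝ (Fin (n + 1) → ℝ),
      (∀ y ∈ latticeSubgroup (n + 1), y ∈ A) → A = ⊤ := by
    intro A hA
    rw [← top_le_iff, ← (Pi.basisFun ℝ (Fin (n + 1))).span_eq]
    refine Submodule.span_le.2 ?_
    rintro _ ⟨i, rfl⟩
    rw [Pi.basisFun_apply]
    exact hA _ (hsingle i)
  -- `w` is bijective, because its image contains the lattice
  have hwinj : Function.Injective w := by
    have hrange : LinearMap.range w.linear = ⊤ := by
      refine htop _ fun y hy => ?_
      obtain ⟨x, hx, hxy⟩ := hw' (y + w 0) (add_mem hy hw0)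
      exact ⟨x, by rw [hlin x] at hxy; exact add_right_cancel hxy⟩
    have := LinearMap.injective_iff_surjective.2 (LinearMap.range_eq_top.1 hrange)
    intro x y hxy
    rw [hlin x, hlin y] at hxy
    exact this (add_right_cancel hxy)
  let T : (Fin (n + 1) → ℝ) →ₗ[ℝ] (Fin (n + 1) → ℝ) :=
    w.linear + (LinearMap.proj (R := ℝ) (φ := fun _ : Fin (n + 1) => ℝ) 0).smulRight (w 0)
  have hT : ∀ x, T x = w.linear x + x 0 • w 0 := fun x => rfl
  have hT1 : ∀ x, x 0 = 1 → T x = w x := fun x hx => by rw [hT, hx, one_smul, hlin x]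
  have hTlat : ∀ x ∈ latticeSubgroup (n + 1), T x ∈ latticeSubgroup (n + 1) := by
    intro x hx
    have h1 := sub_mem (hw x hx) hw0
    rw [hlin x, add_sub_cancel_right] at h1
    rw [hT]
    refine add_mem h1 ?_
    obtain ⟨a, rfl⟩ := hx
    have h2 := zsmul_mem hw0 (a 0)
    rwa [← Int.cast_smul_eq_zsmul ℝ] at h2
  have hTsurj : ∀ y ∈ latticeSubgroup (n + 1), ∃ x ∈ latticeSubgroup (n + 1), T x = y := by
    have hle : latticeSubgroup (n + 1) ≤ (latticeSubgroup (n + 1)).map T.toAddMonoidHom := by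
      refine latticeSubgroup_le fun y hy hy0 => ?_
      obtain ⟨x, hx, hxy⟩ := hw' y hy
      obtain ⟨x', hx', hxy'⟩ := hbij.surjOn (mem_hyperplaneOneAffine.2 hy0)
      have hxx : x = x' := hwinj (hxy.trans hxy'.symm)
      subst hxx
      exact ⟨x, hx, (hT1 x (mem_hyperplaneOneAffine.1 hx')).trans hxy⟩
    exact fun y hy => hle hy
  have hrange : LinearMap.range T = ⊤ := htop _ fun y hy => by
    obtain ⟨x, _, hxy⟩ := hTsurj y hy
    exact ⟨x, hxy⟩
  have hTs := LinearMap.range_eq_top.1 hrange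
  let L := LinearEquiv.ofBijective T ⟨LinearMap.injective_iff_surjective.2 hTs, hTs⟩
  refine ToricLCI.nonempty_dualMonoid_equiv L hTlat (fun y hy => ?_) ?_
  · obtain ⟨x, hx, hxy⟩ := hTsurj y hy
    have : L.symm y = x := by rw [LinearEquiv.symm_apply_eq]; exact hxy.symm
    rw [this]
    exact hx
  · rw [← hPQ]
    exact Set.image_congr fun x hx => hT1 x (hP hx)

end LatticeEquiv

/-! ### Affine schemes over `ℂ` -/

section Schemes

variable {A B : Type} [CommRing A] [Algebra ℂ A] [CommRing B] [Algebra ℂ B]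

/-- Isomorphic algebras have isomorphic spectra. -/
noncomputable def specOverIso (e : A ≃ₐ[ℂ] B) : specOver B ≅ specOver A :=
  Over.isoMk (Scheme.Spec.mapIso e.toRingEquiv.toCommRingCatIso.op) (by
    simp only [specOver, Functor.mapIso_hom, Iso.op_hom, Scheme.Spec_map, Over.mk_hom]
    erw [← Spec.map_comp]
    congr 1
    ext x
    exact e.commutes x)

/-- Closed embeddings of `Spec A` into affine space are systems of generators of `A`. -/
lemma embedsInAffineSpace_iff (k : ℕ) : EmbedsInAffineSpace (specOver A) k ↔
    ∃ f : MvPolynomial (Fin k) ℂ →ₐ[ℂ] A, Function.Surjective f := by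
  constructor
  · rintro ⟨i, hi⟩
    let i' : Spec (CommRingCat.of A) ⟶ 𝔸(Fin k; Spec (CommRingCat.of ℂ)) := i.left
    have hi' : IsClosedImmersion i' := hi
    have hw : i' ≫ 𝔸(Fin k; Spec (CommRingCat.of ℂ)) ↘ Spec (CommRingCat.of ℂ) =
        Spec.map (CommRingCat.ofHom (algebraMap ℂ A)) := Over.w i
    obtain ⟨φ, hφ⟩ := Spec.map_surjective
      (i' ≫ (AffineSpace.SpecIso (Fin k) (CommRingCat.of ℂ)).hom)
    have hcl : IsClosedImmersion (Spec.map φ) := by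
      rw [hφ]
      infer_instance
    have hsurj : Function.Surjective φ := by
      have h1 := (IsClosedImmersion.isAffine_surjective_of_isAffine (Spec.map φ)).2
      have h2 : φ = (Scheme.ΓSpecIso _).inv ≫ (Spec.map φ).appTop ≫ (Scheme.ΓSpecIso _).hom := by
        rw [← Category.assoc, ← Scheme.ΓSpecIso_inv_naturality, Category.assoc, Iso.inv_hom_id,
          Category.comp_id]
      rw [h2]
      exact ((ConcreteCategory.bijective_of_isIso (Scheme.ΓSpecIso _).hom).2.comp h1).comp
        (ConcreteCategory.bijective_of_isIso (Scheme.ΓSpecIso _).inv).2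
    have hcomm : CommRingCat.ofHom MvPolynomial.C ≫ φ =
        CommRingCat.ofHom (algebraMap ℂ A) := by
      apply Spec.map_injective
      rw [Spec.map_comp, hφ, ← hw, ← AffineSpace.SpecIso_inv_over, Category.assoc,
        Iso.hom_inv_id_assoc]
    exact ⟨{ φ.hom with
      commutes' := fun c => congrArg (fun f => f.hom c) hcomm }, hsurj⟩
  · rintro ⟨f, hf⟩
    let g : Spec (CommRingCat.of A) ⟶
        Spec (CommRingCat.of (MvPolynomial (Fin k) (CommRingCat.of ℂ))) :=
      Spec.map (CommRingCat.ofHom f.toRingHom)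
    have hcl : IsClosedImmersion g := IsClosedImmersion.spec_of_surjective _ hf
    have hcl' : IsClosedImmersion (g ≫ (AffineSpace.SpecIso (Fin k) (CommRingCat.of ℂ)).inv) :=
      inferInstance
    have hw : (g ≫ (AffineSpace.SpecIso (Fin k) (CommRingCat.of ℂ)).inv) ≫
        𝔸(Fin k; Spec (CommRingCat.of ℂ)) ↘ Spec (CommRingCat.of ℂ) =
        Spec.map (CommRingCat.ofHom (algebraMap ℂ A)) := by
      rw [Category.assoc, AffineSpace.SpecIso_inv_over]
      erw [← Spec.map_comp]
      congr 1
      ext c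
      exact f.commutes c
    exact ⟨Over.homMk _ hw, hcl'⟩

end Schemes

/-! ### The embedding dimension at the fixed point -/

/-- Let `Θ` be a homomorphism to the square-zero extension of `ℂ` by `ℂ^ι` that maps the ideal
`I` onto the square-zero ideal. Generators of `I` are mapped to generators of `ℂ^ι`, so `I` needs
at least `#ι` of them. -/
lemma card_le_spanFinrank {A : Type*} [CommRing A] {I : Ideal A} (hI : I.FG) {ι : Type*}
    [Fintype ι] [DecidableEq ι] (Θ : A →+* TrivSqZeroExt ℂ (ι → ℂ))
    (h0 : ∀ t ∈ I, (Θ t).fst = 0)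
    (h1 : ∀ i, ∃ t ∈ I, Θ t = TrivSqZeroExt.inr (Pi.single i 1)) :
    Fintype.card ι ≤ I.spanFinrank := by
  classical
  obtain ⟨s, hs, hspan⟩ := Submodule.FG.exists_span_finset_card_eq_spanFinrank hI
  let W := Submodule.span ℂ ((s.image fun t => (Θ t).snd : Finset (ι → ℂ)) : Set (ι → ℂ))
  have hW : ∀ t ∈ I, (Θ t).snd ∈ W := by
    intro t ht
    rw [← hspan] at ht
    induction ht using Submodule.span_induction with
    | mem t ht =>
      exact Submodule.subset_span (Finset.mem_coe.2 (Finset.mem_image_of_mem _ ht))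
    | zero => simp
    | add x y _ _ hx hy =>
      rw [map_add, TrivSqZeroExt.snd_add]
      exact add_mem hx hy
    | smul a x hx hx' =>
      have hx0 : (Θ x).fst = 0 := h0 x (hspan ▸ hx)
      rw [smul_eq_mul, map_mul, TrivSqZeroExt.snd_mul, hx0]
      simpa using W.smul_mem _ hx'
  have htop : W = ⊤ := by
    rw [← top_le_iff, ← (Pi.basisFun ℂ ι).span_eq]
    refine Submodule.span_le.2 ?_
    rintro _ ⟨i, rfl⟩
    obtain ⟨t, ht, hti⟩ := h1 i
    have := hW t ht
    rw [hti] at this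
    simpa using this
  calc Fintype.card ι = Module.finrank ℂ (ι → ℂ) := (Module.finrank_fintype_fun_eq_card ℂ).symm
    _ = Module.finrank ℂ W := by rw [htop, finrank_top]
    _ ≤ (s.image fun t => (Θ t).snd).card := finrank_span_finset_le_card _
    _ ≤ s.card := Finset.card_image_le
    _ = I.spanFinrank := hs

open scoped Classical in
/-- The homomorphism `f ↦ (f(orb), linear part of f)`: the characters of the elements of the
Hilbert basis are mapped to the basis vectors of the square-zero ideal, all other characters
`e(a)` with `a ≠ 0` to zero. It is multiplicative because sums of two non-zero elements do not
belong to the Hilbert basis. -/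
noncomputable def linearPart (hm : IsAdmissible m) : toricRing (nakajimaCone m) →ₐ[ℂ]
    TrivSqZeroExt ℂ (hilbertBasis (dualMonoid (nakajimaCone m)) → ℂ) :=
  AddMonoidAlgebra.lift ℂ _ _
    { toFun := fun a => if a.toAdd = 0 then 1 else
        TrivSqZeroExt.inr fun h => if h.1 = (a.toAdd : Fin (n + 1) → ℤ) then 1 else 0
      map_one' := if_pos rfl
      map_mul' := fun a b => by
        by_cases ha : a.toAdd = 0
        · simp [ha]
        by_cases hb : b.toAdd = 0
        · simp [hb]
        have hab : (a * b).toAdd ≠ 0 := fun h => ha (Subtype.ext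
          (eq_zero_of_add_eq_zero hm a.toAdd.2 b.toAdd.2 (congrArg Subtype.val h)))
        rw [if_neg ha, if_neg hb, if_neg hab, TrivSqZeroExt.inr_mul_inr]
        refine (congrArg _ ?_).trans (TrivSqZeroExt.inr_zero _)
        ext h
        refine if_neg fun heq => h.2.2.2 ⟨_, a.toAdd.2, _, b.toAdd.2, ?_, ?_, heq⟩
        · exact fun h0 => ha (Subtype.ext h0)
        · exact fun h0 => hb (Subtype.ext h0) }

open scoped Classical in
lemma linearPart_character (hm : IsAdmissible m) (a : dualMonoid (nakajimaCone m)) :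
    linearPart hm (character _ a) = if a = 0 then 1 else
        TrivSqZeroExt.inr fun h => if h.1 = (a : Fin (n + 1) → ℤ) then 1 else 0 := by
  rw [linearPart, character, AddMonoidAlgebra.lift_single, one_smul]
  rfl

/-- The value at the fixed point. -/
noncomputable def augmentation (hm : IsAdmissible m) : toricRing (nakajimaCone m) →ₐ[ℂ] ℂ :=
  (TrivSqZeroExt.fstHom ℂ ℂ _).comp (linearPart hm)

lemma augmentation_apply (hm : IsAdmissible m) (f : toricRing (nakajimaCone m)) :
    augmentation hm f = (linearPart hm f).fst := rfl

lemma augmentation_character (hm : IsAdmissible m) {a : dualMonoid (nakajimaCone m)}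
    (ha : a ≠ 0) : augmentation hm (character _ a) = 0 := by
  rw [augmentation_apply, linearPart_character, if_neg ha, TrivSqZeroExt.fst_inr]

lemma character_mem_orbIdeal {a : dualMonoid (nakajimaCone m)} (ha : a ≠ 0) :
    character _ a ∈ orbIdeal (nakajimaCone m) := Ideal.subset_span ⟨a, ha, rfl⟩

lemma ker_augmentation (hm : IsAdmissible m) :
    RingHom.ker (augmentation hm) = orbIdeal (nakajimaCone m) := by
  refine le_antisymm (fun f hf => ?_) (Ideal.span_le.2 ?_)
  · have key : ∀ f, f - algebraMap ℂ _ (augmentation hm f) ∈ orbIdeal (nakajimaCone m) := by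
      intro f
      induction f using AddMonoidAlgebra.induction_linear with
      | zero => simp
      | add f g hf hg =>
        rw [map_add, map_add, add_sub_add_comm]
        exact add_mem hf hg
      | single a r =>
        have h : (AddMonoidAlgebra.single a r : toricRing (nakajimaCone m)) =
            r • character _ a := by
          rw [character, AddMonoidAlgebra.smul_single, smul_eq_mul, mul_one]
        rw [h, map_smul]
        by_cases ha : a = 0
        · subst ha
          rw [character_zero, map_one, smul_eq_mul, mul_one, Algebra.algebraMap_eq_smul_one,
            sub_self]
          exact zero_mem _
        · rw [augmentation_character hm ha, smul_zero, map_zero, sub_zero]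
          exact Submodule.smul_of_tower_mem _ r (character_mem_orbIdeal ha)
    have := key f
    rwa [(RingHom.mem_ker).1 hf, map_zero, sub_zero] at this
  · rintro _ ⟨a, ha, rfl⟩
    exact augmentation_character hm ha

lemma isMaximal_orbIdeal (hm : IsAdmissible m) : (orbIdeal (nakajimaCone m)).IsMaximal := by
  rw [← ker_augmentation hm]
  refine RingHom.ker_isMaximal_of_surjective _ fun c => ⟨algebraMap ℂ _ c, ?_⟩
  exact (augmentation hm).commutes c

lemma mem_orbIdeal_iff (hm : IsAdmissible m) {f : toricRing (nakajimaCone m)} :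
    f ∈ orbIdeal (nakajimaCone m) ↔ (linearPart hm f).fst = 0 := by
  rw [← ker_augmentation hm, RingHom.mem_ker, augmentation_apply]

/-- The basis vectors of the square-zero ideal come from the Hilbert basis. -/
lemma exists_linearPart_eq [DecidableEq (hilbertBasis (dualMonoid (nakajimaCone m)))]
    (hm : IsAdmissible m) (h : hilbertBasis (dualMonoid (nakajimaCone m))) :
    ∃ f ∈ orbIdeal (nakajimaCone m), linearPart hm f = TrivSqZeroExt.inr (Pi.single h 1) := by
  have hne : (⟨h.1, h.2.1⟩ : dualMonoid (nakajimaCone m)) ≠ 0 := fun h0 =>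
    h.2.2.1 (congrArg Subtype.val h0)
  refine ⟨_, character_mem_orbIdeal hne, ?_⟩
  rw [linearPart_character, if_neg hne]
  congr 1
  ext h'
  simp [Pi.single_apply, Subtype.ext_iff]

/-- The maximal ideal is generated by the characters of the remaining variables. -/
lemma orbIdeal_eq_span {γ : Fin (n + 1) → Fin n} {δ : Fin n → Fin n} (hc : IsIndexChoice m γ δ)
    (hm : IsAdmissible m) : orbIdeal (nakajimaCone m) =
      Ideal.span (Set.range fun w : RemVar m => evalRem hm (MvPolynomial.X w)) := by
  refine le_antisymm (Ideal.span_le.2 ?_) (Ideal.span_le.2 ?_)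
  · rintro _ ⟨a, ha, rfl⟩
    obtain ⟨u, hu⟩ := exists_weight_eq hm a.2
    obtain ⟨E, hE⟩ := exists_elim_monomial hc hm
    have h1 : evalRem hm (MvPolynomial.monomial (E u) 1) = character _ a := by
      rw [← (hE u).1]
      refine (evalVec_inclusion_elim hc hm _).trans ?_
      rw [evalVec_monomial]
      exact congrArg _ (Subtype.ext hu)
    have hne : E u ≠ 0 := by
      intro h0
      rw [h0] at h1
      have h2 : character (nakajimaCone m) 0 = character _ a := by
        rw [← h1, character_zero]
        exact (map_one (evalRem hm)).symm
      exact ha (character_injective _ h2).symm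
    obtain ⟨w, hw⟩ := Finsupp.support_nonempty_iff.2 hne
    have hle : Finsupp.single w 1 ≤ E u := by
      rw [Finsupp.single_le_iff]
      exact Nat.one_le_iff_ne_zero.2 (Finsupp.mem_support_iff.1 hw)
    obtain ⟨e, he⟩ := exists_add_of_le hle
    have h3 : (MvPolynomial.monomial (E u) 1 : MvPolynomial (RemVar m) ℂ) =
        MvPolynomial.X w * MvPolynomial.monomial e 1 := by
      rw [he, MvPolynomial.X, MvPolynomial.monomial_mul, one_mul]
    rw [SetLike.mem_coe, ← h1, h3, map_mul]
    exact Ideal.mul_mem_right _ _ (Ideal.subset_span ⟨w, rfl⟩)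
  · rintro _ ⟨w, rfl⟩
    simp only [evalRem_X]
    exact character_mem_orbIdeal fun h0 => vec_ne_zero hm w.toVar (congrArg Subtype.val h0)

lemma card_remVar (hm : IsAdmissible m) :
    Nat.card (RemVar m) = (hilbertBasis (dualMonoid (nakajimaCone m))).ncard := by
  rw [ncard_hilbertBasis hm, ← range_toVar hm, ← Set.image_univ,
    Set.ncard_image_of_injective _ toVar_injective, Set.ncard_univ]

lemma fg_orbIdeal {γ : Fin (n + 1) → Fin n} {δ : Fin n → Fin n} (hc : IsIndexChoice m γ δ)
    (hm : IsAdmissible m) : (orbIdeal (nakajimaCone m)).FG := by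
  rw [orbIdeal_eq_span hc hm]
  exact Submodule.fg_span (Set.finite_range _)

lemma spanFinrank_orbIdeal_le {γ : Fin (n + 1) → Fin n} {δ : Fin n → Fin n}
    (hc : IsIndexChoice m γ δ) (hm : IsAdmissible m) :
    (orbIdeal (nakajimaCone m)).spanFinrank ≤
      (hilbertBasis (dualMonoid (nakajimaCone m))).ncard := by
  rw [orbIdeal_eq_span hc hm, ← card_remVar hm]
  refine (Submodule.spanFinrank_span_le_ncard_of_finite (Set.finite_range _)).trans ?_
  rw [← Set.image_univ, ← Set.ncard_univ (RemVar m)]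
  exact Set.ncard_image_le (Set.toFinite _)

lemma ncard_le_spanFinrank_orbIdeal {γ : Fin (n + 1) → Fin n} {δ : Fin n → Fin n}
    (hc : IsIndexChoice m γ δ) (hm : IsAdmissible m) :
    (hilbertBasis (dualMonoid (nakajimaCone m))).ncard ≤
      (orbIdeal (nakajimaCone m)).spanFinrank := by
  classical
  have := (finite_hilbertBasis hm).fintype
  rw [← Nat.card_coe_set_eq, Nat.card_eq_fintype_card]
  exact card_le_spanFinrank (fg_orbIdeal hc hm) (linearPart hm).toRingHom
    (fun f hf => (mem_orbIdeal_iff hm).1 hf) (exists_linearPart_eq hm)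

/-- The number of elements of the Hilbert basis is the embedding dimension of the local ring at
the fixed point: `linearPart` extends to the localization. -/
lemma spanFinrank_maximalIdeal {γ : Fin (n + 1) → Fin n} {δ : Fin n → Fin n}
    (hc : IsIndexChoice m γ δ) (hm : IsAdmissible m)
    (hprime : (orbIdeal (nakajimaCone m)).IsPrime) :
    (IsLocalRing.maximalIdeal (Localization.AtPrime (orbIdeal (nakajimaCone m)))).spanFinrank =
      (hilbertBasis (dualMonoid (nakajimaCone m))).ncard := by
  classical
  have hmap := Localization.AtPrime.map_eq_maximalIdeal (I := orbIdeal (nakajimaCone m))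
  refine le_antisymm ?_ ?_
  · rw [← hmap]
    exact (Ideal.spanFinrank_map_le_of_fg _ (fg_orbIdeal hc hm)).trans
      (spanFinrank_orbIdeal_le hc hm)
  · have hunit : ∀ y : (orbIdeal (nakajimaCone m)).primeCompl,
        IsUnit ((linearPart hm).toRingHom y) := fun y => by
      rw [TrivSqZeroExt.isUnit_iff_isUnit_fst, isUnit_iff_ne_zero]
      exact fun h => y.2 ((mem_orbIdeal_iff hm).2 h)
    let Θ : Localization.AtPrime (orbIdeal (nakajimaCone m)) →+*
        TrivSqZeroExt ℂ (hilbertBasis (dualMonoid (nakajimaCone m)) → ℂ) :=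
      IsLocalization.lift (M := (orbIdeal (nakajimaCone m)).primeCompl) hunit
    have hΘ : ∀ f, Θ (algebraMap _ _ f) = linearPart hm f := fun f => IsLocalization.lift_eq _ f
    have := (finite_hilbertBasis hm).fintype
    rw [← Nat.card_coe_set_eq, Nat.card_eq_fintype_card]
    refine card_le_spanFinrank ?_ Θ (fun t ht => ?_) fun h => ?_
    · rw [← hmap]
      exact (fg_orbIdeal hc hm).map _
    · have hle : (orbIdeal (nakajimaCone m)).map (algebraMap _ (Localization.AtPrime _)) ≤
          RingHom.ker ((TrivSqZeroExt.fstHom ℂ ℂ _).toRingHom.comp Θ) := by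
        refine Ideal.map_le_iff_le_comap.2 fun f hf => ?_
        rw [Ideal.mem_comap, RingHom.mem_ker, RingHom.comp_apply, hΘ]
        exact (mem_orbIdeal_iff hm).1 hf
      rw [hmap] at hle
      exact hle ht
    · obtain ⟨f, hf, hfh⟩ := exists_linearPart_eq hm h
      refine ⟨algebraMap _ _ f, ?_, (hΘ f).trans hfh⟩
      rw [← hmap]
      exact Ideal.mem_map_of_mem _ hf

/-- If `k` elements generate the algebra `ℂ[S]`, subtracting their values at the fixed point
gives `k` generators of the maximal ideal. -/
lemma spanFinrank_orbIdeal_le_of_surjective (hm : IsAdmissible m) {k : ℕ}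
    (f : MvPolynomial (Fin k) ℂ →ₐ[ℂ] toricRing (nakajimaCone m))
    (hf : Function.Surjective f) : (orbIdeal (nakajimaCone m)).spanFinrank ≤ k := by
  let t : Fin k → toricRing (nakajimaCone m) := fun i =>
    f (MvPolynomial.X i) - algebraMap ℂ _ (augmentation hm (f (MvPolynomial.X i)))
  have hle : orbIdeal (nakajimaCone m) ≤ Ideal.span (Set.range t) := by
    intro g hg
    obtain ⟨p, rfl⟩ := hf g
    have h1 : (Ideal.Quotient.mkₐ ℂ (Ideal.span (Set.range t))).comp f =
        (Algebra.ofId ℂ _).comp ((augmentation hm).comp f) := by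
      refine MvPolynomial.algHom_ext fun i => ?_
      have h2 : t i ∈ Ideal.span (Set.range t) := Ideal.subset_span ⟨i, rfl⟩
      exact Ideal.Quotient.eq.2 h2
    have h2 := DFunLike.congr_fun h1 p
    rw [← ker_augmentation hm, RingHom.mem_ker] at hg
    simp only [AlgHom.comp_apply, hg, map_zero] at h2
    exact Ideal.Quotient.eq_zero_iff_mem.1 h2
  have hspan : orbIdeal (nakajimaCone m) = Ideal.span (Set.range t) := by
    refine le_antisymm hle (Ideal.span_le.2 ?_)
    rintro _ ⟨i, rfl⟩
    rw [SetLike.mem_coe, ← ker_augmentation hm, RingHom.mem_ker, map_sub, AlgHom.commutes]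
    exact sub_self _
  rw [hspan]
  refine (Submodule.spanFinrank_span_le_ncard_of_finite (Set.finite_range _)).trans ?_
  rw [← Set.image_univ]
  refine (Set.ncard_image_le (Set.toFinite _)).trans ?_
  rw [Set.ncard_univ, Nat.card_eq_fintype_card, Fintype.card_fin]

lemma isLeast_embedding {γ : Fin (n + 1) → Fin n} {δ : Fin n → Fin n}
    (hc : IsIndexChoice m γ δ) (hm : IsAdmissible m) :
    IsLeast {k : ℕ | EmbedsInAffineSpace (toricVariety (nakajimaCone m)) k}
      (hilbertBasis (dualMonoid (nakajimaCone m))).ncard := by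
  constructor
  · refine (embedsInAffineSpace_iff _).2 ?_
    have e : Fin (hilbertBasis (dualMonoid (nakajimaCone m))).ncard ≃ RemVar m :=
      (Finite.equivFinOfCardEq (card_remVar hm)).symm
    exact ⟨(evalRem hm).comp (MvPolynomial.renameEquiv ℂ e).toAlgHom,
      (evalRem_surjective hc hm).comp (MvPolynomial.renameEquiv ℂ e).surjective⟩
  · intro k hk
    obtain ⟨f, hf⟩ := (embedsInAffineSpace_iff _).1 hk
    exact (ncard_le_spanFinrank_orbIdeal hc hm).trans
      (spanFinrank_orbIdeal_le_of_surjective hm f hf)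

end ToricLCI

theorem corollary3p4 (n : ℕ) (hn : 2 ≤ n) (m : Fin n → Fin (n + 1) → ℤ)
    (hm : ToricLCI.IsAdmissible m)
    (P : Set (Fin (n + 1) → ℝ)) (hP : P ⊆ ToricLCI.hyperplaneOne n)
    (hPm : ToricLCI.LatticeEquiv P (ToricLCI.nakajimaPolytope m))
    (γ : Fin (n + 1) → Fin n) (δ : Fin n → Fin n) (hc : ToricLCI.IsIndexChoice m γ δ) :
    -- the varieties of `P` and of `P_m^(d)` are isomorphic
    Nonempty (ToricLCI.toricVariety (ToricLCI.coneOver P) ≅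
      ToricLCI.toricVariety (ToricLCI.nakajimaCone m)) ∧
    -- the Hilbert basis is finite; its cardinality is the least dimension of an affine space that
    -- contains the variety as a closed subscheme, and the embedding dimension at the fixed point
    (ToricLCI.hilbertBasis (ToricLCI.dualMonoid (ToricLCI.nakajimaCone m))).Finite ∧
    IsLeast {k : ℕ | ToricLCI.EmbedsInAffineSpace
        (ToricLCI.toricVariety (ToricLCI.nakajimaCone m)) k}
      (ToricLCI.hilbertBasis (ToricLCI.dualMonoid (ToricLCI.nakajimaCone m))).ncard ∧
    (∃ h : (ToricLCI.orbIdeal (ToricLCI.nakajimaCone m)).IsMaximal,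
      haveI := h.isPrime
      (IsLocalRing.maximalIdeal
        (Localization.AtPrime (ToricLCI.orbIdeal (ToricLCI.nakajimaCone m)))).spanFinrank =
      (ToricLCI.hilbertBasis (ToricLCI.dualMonoid (ToricLCI.nakajimaCone m))).ncard) ∧
    -- the remaining variables correspond exactly to the elements of the Hilbert basis
    Set.BijOn (ToricLCI.vec m) (Set.range (ToricLCI.RemVar.toVar (m := m)))
      (ToricLCI.hilbertBasis (ToricLCI.dualMonoid (ToricLCI.nakajimaCone m))) ∧
    -- presentation by the remaining variables and the remaining binomials
    Nonempty (ToricLCI.toricVariety (ToricLCI.coneOver P) ≅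
      ToricLCI.specOver (MvPolynomial (ToricLCI.RemVar m) ℂ ⧸ ToricLCI.remainingIdeal hc)) ∧
    (∃ φ : (MvPolynomial (ToricLCI.RemVar m) ℂ ⧸ ToricLCI.remainingIdeal hc) ≃ₐ[ℂ]
        ToricLCI.toricRing (ToricLCI.nakajimaCone m),
      ∀ v : ToricLCI.RemVar m,
        ∃ h : ToricLCI.vec m v.toVar ∈ ToricLCI.dualMonoid (ToricLCI.nakajimaCone m),
          φ (Ideal.Quotient.mk _ (MvPolynomial.X v)) =
            ToricLCI.character (ToricLCI.nakajimaCone m) ⟨ToricLCI.vec m v.toVar, h⟩) ∧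
    -- the exponents are non-negative, and there are `#Hilb - d` remaining binomials
    (∀ (j : Fin n) (c : Fin (n + 1)), 0 ≤ ToricLCI.mu m j c ∧ ToricLCI.lam m j c ≤ 0) ∧
    (∀ p ∈ ToricLCI.remainingBinomials hc, ToricLCI.IsBinomial p) ∧
    (ToricLCI.remainingBinomials hc).ncard + (n + 1) =
      (ToricLCI.hilbertBasis (ToricLCI.dualMonoid (ToricLCI.nakajimaCone m))).ncard := by
  have hspan := ToricLCI.span_nakajimaPolytope hm
  have hQ : ToricLCI.nakajimaPolytope m ⊆ ToricLCI.hyperplaneOne n := fun x hx =>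
    ToricLCI.apply_zero_of_mem_stage hx
  obtain ⟨e⟩ := hPm.nonempty_dualMonoid_equiv hP hQ hspan
  have iso : ToricLCI.toricVariety (ToricLCI.coneOver P) ≅
      ToricLCI.toricVariety (ToricLCI.nakajimaCone m) :=
    ToricLCI.specOverIso (AddMonoidAlgebra.domCongr ℂ ℂ e.symm)
  have hmax := ToricLCI.isMaximal_orbIdeal hm
  refine ⟨⟨iso⟩, ToricLCI.finite_hilbertBasis hm, ToricLCI.isLeast_embedding hc hm,
    ⟨hmax, ToricLCI.spanFinrank_maximalIdeal hc hm hmax.isPrime⟩, ToricLCI.bijOn_vec hm,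
    ⟨iso ≪≫ ToricLCI.specOverIso (ToricLCI.remainingEquiv hc hm)⟩,
    ⟨ToricLCI.remainingEquiv hc hm, fun v => ⟨ToricLCI.vec_mem hm _, ?_⟩⟩,
    fun j c => ⟨ToricLCI.mu_nonneg hm j c, ToricLCI.lam_nonpos m j c⟩, ?_,
    ToricLCI.ncard_remainingBinomials hc hm⟩
  · rw [ToricLCI.remainingEquiv_mk, ToricLCI.evalRem_X]
  · rw [ToricLCI.remainingBinomials_eq hc hm]
    rintro _ ⟨j, hj, rfl⟩
    exact (ToricLCI.isBinomial_and_injOn hc hm).1 j hj
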